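/- **Seifert plumbing.** Let $k\ge 0$, $b\in\mathbb Z$, and let $(a_i,b_i)$, $1\le i\le k$, be pairs of coprime integers with $a_i\ge 1$. For each $i$ let $$\frac{a_i}{b_i}=c^i_1-\cfrac{1}{c^i_2-\cfrac{1}{\ddots-\cfrac1{c^i_{\ell_i}}}}$$ be a continued fraction expansion with integers $c^i_j$ and $\ell_i\ge1$. The Seifert manifold $M=M(b;(a_1,b_1),\dots,(a_k,b_k))$ is given by the star-shaped plumbing tree $\Gamma$ with central vertex of weight $-b$ and $k$ legs with weights $-c^i_1,\dots,-c^i_{\ell_i}$, read outwards; let $v_i$ be the last vertex of the $i$-th leg. Let $s$ be the number of vertices, $\delta\in\mathbb Z^s$ the vector of degrees, $m\in\mathbb Z^s$ the vector of weights, $u=(1,\dots,1)$, and write $M$ also for the $s\times s$ plumbing matrix, with $M_{vv}=m_v$, and for $v\ne w$, $M_{vw}=1$ if $v,w$ are adjacent and $0$ otherwise. Assume that $M$ is negative definite. Put $\langle x,y\rangle=x^tMy$, and let $H=H_1(M;\mathbb Z)=\mathbb Z^s/M\mathbb Z^s$ and $\mathrm{spin}^c(M)=(m+2\mathbb Z^s)/2M\mathbb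 Z^s$. **The series.** For a rational function $f(z)$ with Laurent expansions $\sum_n \alpha_nz^n$ at $z=0$ and $\sum_n\beta_nz^{-n}$ at $z=\infty$, the symmetric expansion is $\mathrm{s.e.}(f)=\frac12\sum_n \alpha_nz^n+\frac12\sum_n\beta_nz^{-n}$. Let $\widehat W_d(n)$ be the coefficient of $z^{-n}$ in $\mathrm{s.e.}\big((z-z^{-1})^{2-d}\big)$. For $\kappa\in m+2\mathbb Z^s$ and $x\in\mathbb Z^s$ put $\chi_\kappa(x)=-\frac{\kappa\cdot x+\langle x,x\rangle}2$, $\Theta_\kappa=\frac{\kappa\cdot u-\langle u,u\rangle}2$ and $$\varepsilon_\kappa(x)=-\frac{(\kappa-Mu)^tM^{-1}(\kappa-Mu)+3s+\sum_vm_v}{4}+2\chi_\kappa(x)+\langle x,u\rangle .$$ Then $$\widehat{\widehat Z}_{[\kappa]}(M)(t,q)=\sum_{x\in\mathbb Z^s}\Big(\prod_v\widehat W_{\delta_v}\big((2Mx+\kappa-Mu)_v\big)\Big)\,q^{\varepsilon_\kappa(x)}\,t^{\Theta_\kappa+\langle x,u\rangle},\qquad \widehat{\widehat Z}_0(M)=\sum_{[\kappa]\in\mathrm{spin}^c(M)}\widehat{\widehat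 Z}_{[\kappa]}(M),$$ as formal series in rational powers of $t$ and $q$. **Theorem.** The groups and sums above are finite where this is needed: $H$ is finite (that is, $b_1(M)=0$), $\mathrm{spin}^c(M)$ is finite, and for each $\kappa$ and each $e\in\mathbb Q$ only finitely many $x\in\mathbb Z^s$ satisfy $\varepsilon_\kappa(x)\le e$. Moreover $$\widehat{\widehat Z}_0(M)(t^2,q^{|H|})=q^{\Delta}\,\mathcal L_A\big(\mathrm{s.e.}(f_0(t,z))\big),$$ where $A=\prod_i a_i$, $$f_0(t,z)=\frac{\prod_{i=1}^k\big(z^{A/a_i}t^{-1}-z^{-A/a_i}t\big)}{\big(z^At^{-1}-z^{-A}t\big)^{k-2}},$$ the symmetric expansion is taken in the variable $z$, $\mathcal L_A$ is the Laplace transform $z^nt^r\mapsto q^{n^2/4A}t^r$, applied term by term, and $$\Delta=-\frac{|H|\,(3s+\operatorname{Tr}M)}{4}-\frac14\sum_{i=1}^k\Big((-1)^s(\operatorname{adj}M)_{v_iv_i}+\frac{A}{a_i^2}\Big).$$ -/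

import Mathlib

open scoped Matrix

noncomputable section

namespace Seifert

/-! ### Formal series in `t` and `q` -/

/-- Formal series `∑ c(a,e) t^a q^e` with rational exponents and rational coefficients;
`F a e` is the coefficient of `t^a q^e`. -/
abbrev TQSeries : Type := ℚ → ℚ → ℚ

/-- `F(t², q^h)`, for `h > 0`: the monomial `t^a q^e` becomes `t^(2a) q^(he)`. -/
def TQSeries.subst (F : TQSeries) (h : ℕ) : TQSeries := fun a e => F (a / 2) (e / h)

/-- `q^Δ · F(t, q)`. -/
def TQSeries.qShift (Δ : ℚ) (F : TQSeries) : TQSeries := fun a e => F a (e - Δ)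

/-! ### Laurent expansions and the symmetric expansion of a rational function -/

section Expansion

variable {K : Type*} [Field K]

/-- The Laurent expansion `∑ aₙ zⁿ` of `f(z)` at `z = 0`. -/
def laurentZero (f : RatFunc K) : LaurentSeries K :=
  f.eval HahnSeries.C (HahnSeries.single (1 : ℤ) (1 : K))

/-- The Laurent expansion `∑ bₙ z⁻ⁿ` of `f(z)` at `z = ∞`, written as the Laurent series
`∑ bₙ wⁿ` in the local coordinate `w = z⁻¹`. -/
def laurentInfty (f : RatFunc K) : LaurentSeries K :=
  f.eval HahnSeries.C (HahnSeries.single (-1 : ℤ) (1 : K))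

/-- The coefficient of `zⁿ` in the symmetric expansion
`½ ∑ aₙ zⁿ + ½ ∑ bₙ z⁻ⁿ` of `f(z)`. -/
def symmetricExpansion (f : RatFunc K) (n : ℤ) : K :=
  (laurentZero f).coeff n / 2 + (laurentInfty f).coeff (-n) / 2

end Expansion

/-- `Ŵ_d(n)`: the coefficient of `z⁻ⁿ` in the symmetric expansion of `(z - z⁻¹)^(2-d)`. -/
def What (d : ℕ) (n : ℤ) : ℚ :=
  symmetricExpansion (((RatFunc.X : RatFunc ℚ) - RatFunc.X⁻¹) ^ (2 - (d : ℤ))) (-n)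

/-! ### Plumbings and their `(t,q)`-series -/

/-- A graph with integer weights on its vertices. -/
structure Plumbing (V : Type*) where
  graph : SimpleGraph V
  weight : V → ℤ

namespace Plumbing

variable {V : Type*} [Fintype V] [DecidableEq V] (Γ : Plumbing V)

/-- The degree `δ_v`. -/
def degree (v : V) : ℕ := (Γ.graph.neighborSet v).ncard

open Classical in
/-- The plumbing matrix. -/
def matrix : Matrix V V ℤ :=
  Matrix.of fun i j => if i = j then Γ.weight i else if Γ.graph.Adj i j then 1 else 0

/-- The plumbing is negative definite. -/
def NegDef : Prop := (-(Γ.matrix.map (Int.cast : ℤ → ℝ))).PosDef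

/-- `H₁(M; ℤ)` of the plumbed 3-manifold, presented by the plumbing (linking) matrix. -/
abbrev H1 : Type _ := (V → ℤ) ⧸ LinearMap.range Γ.matrix.mulVecLin

/-- The bilinear form `⟨x, y⟩ = xᵗ M y`. -/
def form (x y : V → ℤ) : ℤ := x ⬝ᵥ (Γ.matrix *ᵥ y)

/-- The vector `u = (1, …, 1)`. -/
def ones : V → ℤ := fun _ => 1

/-- The set `m + 2ℤˢ`. -/
def CharVec : Type _ := {k : V → ℤ // ∀ v, k v ≡ Γ.weight v [ZMOD 2]}

/-- Two elements of `m + 2ℤˢ` are equivalent when they differ by an element of `2Mℤˢ`. -/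
def spinSetoid : Setoid Γ.CharVec where
  r k k' := ∃ y : V → ℤ, k'.1 = k.1 + 2 • (Γ.matrix *ᵥ y)
  iseqv :=
    { refl := fun k => ⟨0, by simp⟩
      symm := by
        rintro k k' ⟨y, hy⟩
        exact ⟨-y, by rw [hy, Matrix.mulVec_neg, smul_neg]; abel⟩
      trans := by
        rintro k k' k'' ⟨y, hy⟩ ⟨y', hy'⟩
        exact ⟨y + y', by rw [hy', hy, Matrix.mulVec_add, smul_add]; abel⟩ }

/-- `spinᶜ(M) = (m + 2ℤˢ) / 2Mℤˢ`. -/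
def SpinC : Type _ := Quotient Γ.spinSetoid

/-- `χ_k(x) = -(k·x + ⟨x,x⟩)/2`. -/
def chi (k x : V → ℤ) : ℚ := -((k ⬝ᵥ x + Γ.form x x : ℤ) : ℚ) / 2

/-- `Θ_k = (k·u - ⟨u,u⟩)/2`. -/
def theta (k : V → ℤ) : ℚ := ((k ⬝ᵥ ones - Γ.form ones ones : ℤ) : ℚ) / 2

/-- `ℓ² = ℓᵗ M⁻¹ ℓ`, for `ℓ ∈ ℤˢ`. -/
def invSq (l : V → ℤ) : ℚ :=
  (fun v => (l v : ℚ)) ⬝ᵥ ((Γ.matrix.map (Int.cast : ℤ → ℚ))⁻¹ *ᵥ fun v => (l v : ℚ))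

/-- `ε_k(x) = -((k - Mu)² + 3s + ∑ m_v)/4 + 2χ_k(x) + ⟨x,u⟩`. -/
def epsilon (k x : V → ℤ) : ℚ :=
  -(Γ.invSq (k - Γ.matrix *ᵥ ones) + 3 * (Fintype.card V : ℚ) + ∑ v, (Γ.weight v : ℚ)) / 4
    + 2 * Γ.chi k x + (Γ.form x ones : ℚ)

/-- `W_{Γ,k}(x) = ∏_v W_{δ_v}((2Mx + k - Mu)_v)`. -/
def Wprod (W : ℕ → ℤ → ℚ) (k x : V → ℤ) : ℚ :=
  ∏ v, W (Γ.degree v) ((2 • (Γ.matrix *ᵥ x) + k - Γ.matrix *ᵥ ones) v)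

/-- The series `∑_{x ∈ ℤˢ} W_{Γ,k}(x) q^{ε_k(x)} t^{Θ_k + ⟨x,u⟩}` of a representative `k`. -/
def seriesOfRep (W : ℕ → ℤ → ℚ) (k : V → ℤ) : TQSeries := fun a e =>
  ∑ᶠ (x : V → ℤ) (_ : Γ.theta k + (Γ.form x ones : ℚ) = a ∧ Γ.epsilon k x = e), Γ.Wprod W k x

theorem matrix_transpose : Γ.matrixᵀ = Γ.matrix := by
  ext i j
  by_cases h : i = j
  · subst h; rfl
  · simp only [matrix, Matrix.transpose_apply, Matrix.of_apply, h, Ne.symm h, if_false]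
    rw [propext (Γ.graph.adj_comm j i)]

theorem dotProduct_mulVec_comm (x y : V → ℤ) :
    x ⬝ᵥ (Γ.matrix *ᵥ y) = y ⬝ᵥ (Γ.matrix *ᵥ x) := by
  rw [Matrix.dotProduct_mulVec, ← Matrix.mulVec_transpose, matrix_transpose, dotProduct_comm]

variable {Γ}

theorem NegDef.isUnit_det (h : Γ.NegDef) :
    IsUnit (Γ.matrix.map (Int.cast : ℤ → ℚ)).det := by
  have h1 : (-(Γ.matrix.map (Int.cast : ℤ → ℝ))).det ≠ 0 := h.det_pos.ne'
  rw [Matrix.det_neg] at h1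
  have h2 : (Γ.matrix.map (Int.cast : ℤ → ℝ)).det = ((Γ.matrix.det : ℤ) : ℝ) := by
    simpa using ((Int.castRingHom ℝ).map_det Γ.matrix).symm
  have h3 : (Γ.matrix.map (Int.cast : ℤ → ℚ)).det = ((Γ.matrix.det : ℤ) : ℚ) := by
    simpa using ((Int.castRingHom ℚ).map_det Γ.matrix).symm
  rw [h3, isUnit_iff_ne_zero]
  intro h0
  apply h1
  rw [h2]
  have : Γ.matrix.det = 0 := by exact_mod_cast h0
  simp [this]

theorem cast_mulVec (x : V → ℤ) :
    (fun v => (((Γ.matrix *ᵥ x) v : ℤ) : ℚ)) =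
      (Γ.matrix.map (Int.cast : ℤ → ℚ)) *ᵥ fun v => (x v : ℚ) := by
  funext v
  simp [Matrix.mulVec, dotProduct]

theorem invSq_add (h : Γ.NegDef) (l y : V → ℤ) :
    Γ.invSq (l + 2 • (Γ.matrix *ᵥ y)) =
      Γ.invSq l + 4 * ((l ⬝ᵥ y : ℤ) : ℚ) + 4 * (Γ.form y y : ℚ) := by
  set N := Γ.matrix.map (Int.cast : ℤ → ℚ) with hN
  have hu : IsUnit N.det := h.isUnit_det
  set L : V → ℚ := fun v => (l v : ℚ) with hL
  set Y : V → ℚ := fun v => (y v : ℚ) with hY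
  have hT : Nᵀ = N := by
    rw [hN, ← Matrix.transpose_map, matrix_transpose]
  have e1 : (fun v => (((l + 2 • (Γ.matrix *ᵥ y)) v : ℤ) : ℚ)) = L + (2 : ℚ) • (N *ᵥ Y) := by
    have := cast_mulVec (Γ := Γ) y
    funext v
    have := congrFun this v
    simp only [← hN, ← hY] at this
    simp [← this, hL]
  have e2 : N⁻¹ *ᵥ (N *ᵥ Y) = Y := by
    rw [Matrix.mulVec_mulVec, Matrix.nonsing_inv_mul _ hu, Matrix.one_mulVec]
  have e3 : (N *ᵥ Y) ⬝ᵥ (N⁻¹ *ᵥ L) = L ⬝ᵥ Y := by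
    rw [dotProduct_comm, Matrix.dotProduct_mulVec, ← Matrix.mulVec_transpose, hT,
      Matrix.mulVec_mulVec, Matrix.mul_nonsing_inv _ hu, Matrix.one_mulVec]
  have e4 : ((l ⬝ᵥ y : ℤ) : ℚ) = L ⬝ᵥ Y := by simp [dotProduct, hL, hY]
  have e5 : (Γ.form y y : ℚ) = (N *ᵥ Y) ⬝ᵥ Y := by
    rw [form, dotProduct_comm, ← cast_mulVec]
    simp [dotProduct, hY]
  unfold invSq
  rw [e1, e4, e5, Matrix.mulVec_add, Matrix.mulVec_smul, e2, ← hN, ← hL]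
  simp only [add_dotProduct, dotProduct_add, smul_dotProduct, dotProduct_smul, e3, smul_eq_mul]
  ring

/-- For a negative definite plumbing the series depends only on the class of `k`. -/
theorem seriesOfRep_congr (h : Γ.NegDef) (W : ℕ → ℤ → ℚ) (k y : V → ℤ) :
    Γ.seriesOfRep W (k + 2 • (Γ.matrix *ᵥ y)) = Γ.seriesOfRep W k := by
  have hform : ∀ x z : V → ℤ, Γ.form (x + z) ones = Γ.form x ones + Γ.form z ones :=
    fun x z => add_dotProduct _ _ _
  have hθ : ∀ x, Γ.theta (k + 2 • (Γ.matrix *ᵥ y)) + (Γ.form x ones : ℚ)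
      = Γ.theta k + (Γ.form (x + y) ones : ℚ) := by
    intro x
    have : (Γ.matrix *ᵥ y) ⬝ᵥ ones = Γ.form y ones := by
      rw [dotProduct_comm, form, dotProduct_mulVec_comm]
    simp only [theta, hform, add_dotProduct, smul_dotProduct, this]
    simp only [nsmul_eq_mul, Nat.cast_ofNat]
    push_cast
    ring
  have hε : ∀ x, Γ.epsilon (k + 2 • (Γ.matrix *ᵥ y)) x = Γ.epsilon k (x + y) := by
    intro x
    have a1 : k + 2 • (Γ.matrix *ᵥ y) - Γ.matrix *ᵥ ones
        = (k - Γ.matrix *ᵥ ones) + 2 • (Γ.matrix *ᵥ y) := by abel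
    have a2 : (k - Γ.matrix *ᵥ ones) ⬝ᵥ y = k ⬝ᵥ y - Γ.form y ones := by
      rw [sub_dotProduct, dotProduct_comm (Γ.matrix *ᵥ ones), form]
    have a3 : (Γ.matrix *ᵥ y) ⬝ᵥ x = Γ.form x y := by rw [dotProduct_comm, form]
    have a4 : Γ.form (x + y) (x + y) = Γ.form x x + 2 * Γ.form x y + Γ.form y y := by
      have := dotProduct_mulVec_comm Γ x y
      simp only [form, Matrix.mulVec_add, add_dotProduct, dotProduct_add] at *
      rw [this]; ring
    simp only [epsilon, chi]
    rw [a1, invSq_add h, a2, a4, hform]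
    simp only [add_dotProduct, smul_dotProduct, a3, dotProduct_add]
    simp only [nsmul_eq_mul, Nat.cast_ofNat]
    push_cast
    ring
  have hW : ∀ x, Γ.Wprod W (k + 2 • (Γ.matrix *ᵥ y)) x = Γ.Wprod W k (x + y) := by
    intro x
    have : 2 • (Γ.matrix *ᵥ x) + (k + 2 • (Γ.matrix *ᵥ y)) - Γ.matrix *ᵥ ones
        = 2 • (Γ.matrix *ᵥ (x + y)) + k - Γ.matrix *ᵥ ones := by
      rw [Matrix.mulVec_add, smul_add]; abel
    simp only [Wprod, this]
  funext a e
  simp only [seriesOfRep, hθ, hε, hW]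
  exact finsum_comp_equiv (Equiv.addRight y)
    (f := fun x => ∑ᶠ (_ : Γ.theta k + (Γ.form x ones : ℚ) = a ∧ Γ.epsilon k x = e), Γ.Wprod W k x)

variable (Γ)

/-- `P^∞_{W,[k]}(M)(t,q)` of a negative definite plumbing with a `spinᶜ` structure `[k]`. -/
def series (h : Γ.NegDef) (W : ℕ → ℤ → ℚ) : Γ.SpinC → TQSeries :=
  Quotient.lift (fun k => Γ.seriesOfRep W k.1) (by
    rintro k k' ⟨y, hy⟩
    rw [hy, seriesOfRep_congr h])

/-- `P^∞_{W,0}(M)(t,q)`, the sum of the series of all `spinᶜ` structures. -/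
def totalSeries (h : Γ.NegDef) (W : ℕ → ℤ → ℚ) : TQSeries := fun a e =>
  ∑ᶠ σ : Γ.SpinC, Γ.series h W σ a e

/-- The `spinᶜ`-summed series of the family `Ŵ`. -/
def Zhathat (h : Γ.NegDef) : TQSeries := Γ.totalSeries h What

end Plumbing

/-! ### The star-shaped plumbing of a Seifert manifold -/

/-- The negative continued fraction `c₁ - 1/(c₂ - 1/(⋯ - 1/c_ℓ))`. -/
def contFrac : List ℤ → ℚ
  | [] => 0
  | [x] => x
  | x :: y :: l => x - 1 / contFrac (y :: l)

section Star

variable {k : ℕ}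

/-- The vertices of the star with legs `c 0, …, c (k-1)`: the central vertex `none`, and the
vertices `(i, j)` of the legs, where `(i, 0)` is next to the centre. -/
abbrev StarVertex (c : Fin k → List ℤ) : Type := Option (Σ i : Fin k, Fin (c i).length)

/-- The edges of the star, oriented away from the centre. -/
def starEdge (c : Fin k → List ℤ) : StarVertex c → StarVertex c → Prop
  | none, some ⟨_, j⟩ => j.1 = 0
  | some ⟨i, j⟩, some ⟨i', j'⟩ => i = i' ∧ j'.1 = j.1 + 1
  | _, none => False

/-- The star-shaped plumbing with central weight `-b` and weights `-c₁ⁱ, …, -c_ℓⁱ` on the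
`i`-th leg, read off from the centre outwards. -/
def starPlumbing (b : ℤ) (c : Fin k → List ℤ) : Plumbing (StarVertex c) where
  graph := SimpleGraph.fromRel (starEdge c)
  weight
    | none => -b
    | some ⟨i, j⟩ => -((c i).get j)

/-- The last vertex of the `i`-th leg. -/
def leaf (c : Fin k → List ℤ) (hc : ∀ i, c i ≠ []) (i : Fin k) : StarVertex c :=
  some ⟨i, ⟨(c i).length - 1, Nat.sub_lt (List.length_pos_of_ne_nil (hc i)) Nat.one_pos⟩⟩

/-- `|H| = |H₁(M; ℤ)|`. -/
def cardH (b : ℤ) (c : Fin k → List ℤ) : ℕ := Nat.card (starPlumbing b c).H1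

/-- The rational exponent
`Δ = -|H| (3s + Tr M)/4 - ¼ ∑ᵢ ((-1)ˢ adj(M)_{vᵢvᵢ} + A/aᵢ²)`, where `A = ∏ aᵢ`, `s` is the number
of vertices and `vᵢ` is the end of the `i`-th leg. -/
def Delta (b : ℤ) (a : Fin k → ℕ) (c : Fin k → List ℤ) (hc : ∀ i, c i ≠ []) : ℚ :=
  -(cardH b c : ℚ) * (3 * (Fintype.card (StarVertex c) : ℚ) + ((starPlumbing b c).matrix.trace : ℚ)) / 4
    - (∑ i, ((((-1) ^ Fintype.card (StarVertex c) *
          (starPlumbing b c).matrix.adjugate (leaf c hc i) (leaf c hc i) : ℤ) : ℚ)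
        + ((∏ j, a j : ℕ) : ℚ) / (a i : ℚ) ^ 2)) / 4

/-- The rational function
`f₀(t,z) = ∏ᵢ (z^(A/aᵢ) t⁻¹ - z^(-A/aᵢ) t) / (z^A t⁻¹ - z^(-A) t)^(k-2)`, with `A = ∏ aᵢ`,
as an element of `ℚ(t)(z)`. -/
def fZero (a : Fin k → ℕ) : RatFunc (RatFunc ℚ) :=
  let z : RatFunc (RatFunc ℚ) := RatFunc.X
  let t : RatFunc (RatFunc ℚ) := RatFunc.C RatFunc.X
  let A : ℕ := ∏ j, a j
  (∏ i, (z ^ (A / a i) * t⁻¹ - (z ^ (A / a i))⁻¹ * t)) /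
    (z ^ A * t⁻¹ - (z ^ A)⁻¹ * t) ^ ((k : ℤ) - 2)

/-- The coefficient of `zⁿ tᵐ` in the symmetric expansion (in `z`) of `f(t,z)`. The coefficient of
`zⁿ` is a rational function of `t`, and `tᵐ` is read off from its expansion at `t = 0`; nothing is
lost if, as for `fZero`, it is a Laurent polynomial in `t`. -/
def symmetricExpansionCoeff (f : RatFunc (RatFunc ℚ)) (n m : ℤ) : ℚ :=
  (laurentZero (symmetricExpansion f n)).coeff m

/-- The Laplace transform `zⁿ tᵐ ↦ q^(n²/4A) tᵐ` of the formal series `∑ g(n,m) zⁿ tᵐ`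
(at most two monomials `zⁿ tᵐ` contribute to each monomial in `t` and `q`). -/
def laplace (A : ℕ) (g : ℤ → ℤ → ℚ) : TQSeries := fun r e =>
  ∑ᶠ (n : ℤ) (m : ℤ) (_ : (m : ℚ) = r ∧ (n : ℚ) ^ 2 / (4 * (A : ℚ)) = e), g n m

end Star

end Seifert

end

namespace Seifert

/-! ### Laurent expansions at zero and infinity as ring homomorphisms -/

section LaurentExpansion

open HahnSeries

variable {K : Type*} [Field K]

/-! Both sides become the same sum over pairs (η, n) of a sign vector η ∈ {±1}^k and an integer n.

On the topological side, put l = 2Mx + κ - Mu. The exponents depend on l alone: that of t is Σ l_v /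
2, and that of q is -(lᵗM⁻¹l + 3s + Tr M)/4 (`theta_add_form`, `epsilon_eq`). Since Mu = m + δ, the
pairs ([κ], x) run once through δ + 2ℤˢ, and the weights vanish off this coset, so the total series
is a sum over all l ∈ ℤˢ (`totalSeries_eq`). For a star, degree 2 forces l_v = 0 and degree 1 forces
l_v = ±1; only the central entry is free (`exists_eq_endVec`).

The arithmetic is in `invSq_endVec`: on such l, the form |H| lᵗM⁻¹l is minus a square (An + Σ
ηᵢA/aᵢ)²/A, minus a sum of terms weighted by ηᵢ² = 1. The latter is therefore constant, and
`adjugate_leaf` identifies it with the adjugate part of Δ. These computations use explicit vectors,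
built from continuants of the legs, that M sends to vectors supported at the centre and the ends.
They also triangularize M, giving det M and hence |H|. Negative definiteness makes the continuants
positive, so aᵢ is the continuant of the i-th leg.

On the analytic side, the numerator of f₀ expands into 2^k signed monomials indexed by η, and the
remaining factor is (w - w⁻¹)^(2-k) at w = z^A t⁻¹. So (η, n) contributes ∏ηᵢ · Ŵ_k(-n) at z^(An + Σ
ηᵢA/aᵢ) t^(-n - Σ ηᵢ), and the two sums agree term by term. -/

theorem eval₂_single_ne_zero {e : ℤ} (he : e ≠ 0) {p : Polynomial K} (hp : p ≠ 0) :
    p.eval₂ (HahnSeries.C : K →+* LaurentSeries K) (single e (1 : K)) ≠ 0 := by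
  have hcoeff : ∀ n : ℕ, (p.eval₂ (HahnSeries.C : K →+* LaurentSeries K)
      (single e (1 : K))).coeff (n * e) = p.coeff n := by
    intro n
    rw [Polynomial.eval₂_eq_sum, Polynomial.sum, HahnSeries.coeff_sum]
    simp only [HahnSeries.single_pow, one_pow, HahnSeries.C_apply, HahnSeries.single_mul_single,
      zero_add, mul_one, HahnSeries.coeff_single, nsmul_eq_mul, mul_left_inj' he, Nat.cast_inj]
    rw [Finset.sum_ite_eq]
    simp
    tauto
  intro h0
  apply hp
  ext n
  rw [← hcoeff n, h0]
  simp

theorem nonZeroDivisors_le_comap_eval₂_single {e : ℤ} (he : e ≠ 0) :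
    nonZeroDivisors (Polynomial K) ≤ (nonZeroDivisors (LaurentSeries K)).comap
      (Polynomial.eval₂RingHom (HahnSeries.C : K →+* LaurentSeries K) (single e (1 : K))) :=
  fun _ hp => mem_nonZeroDivisors_of_ne_zero
    (eval₂_single_ne_zero he (nonZeroDivisors.ne_zero hp))

/-- Substitution of `z ^ e` for the variable, as a ring homomorphism into Laurent series. -/
noncomputable def evalSingle (e : ℤ) (he : e ≠ 0) : RatFunc K →+* LaurentSeries K :=
  RatFunc.liftRingHom
    (Polynomial.eval₂RingHom (HahnSeries.C : K →+* LaurentSeries K) (single e (1 : K)))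
    (nonZeroDivisors_le_comap_eval₂_single he)

theorem evalSingle_apply (e : ℤ) (he : e ≠ 0) (f : RatFunc K) :
    evalSingle e he f = f.eval HahnSeries.C (single e (1 : K)) := by
  rw [evalSingle, RatFunc.liftRingHom_apply]
  rfl

theorem evalSingle_X (e : ℤ) (he : e ≠ 0) :
    evalSingle e he (RatFunc.X : RatFunc K) = single e 1 := by
  rw [evalSingle_apply, RatFunc.eval_X]

theorem evalSingle_C (e : ℤ) (he : e ≠ 0) (x : K) :
    evalSingle e he (RatFunc.C x) = single 0 x := by
  rw [evalSingle_apply, RatFunc.eval_C]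
  rfl

theorem laurentZero_eq (f : RatFunc K) : laurentZero f = evalSingle 1 one_ne_zero f :=
  (evalSingle_apply _ _ _).symm

theorem laurentInfty_eq (f : RatFunc K) : laurentInfty f = evalSingle (-1) (by norm_num) f :=
  (evalSingle_apply _ _ _).symm

/-- The Laurent series `∑ φ(cₙ) τⁿ zⁿ`. -/
noncomputable def rescale {F : Type*} [Field F] (φ : F →+* K) (τ : K) (G : LaurentSeries F) :
    LaurentSeries K where
  coeff n := φ (G.coeff n) * τ ^ n
  isPWO_support' := G.isPWO_support.mono (show Function.support _ ⊆ G.support from fun n hn => by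
    contrapose! hn
    simp at hn
    simp [hn])

theorem rescale_coeff {F : Type*} [Field F] (φ : F →+* K) (τ : K) (G : LaurentSeries F) (n : ℤ) :
    (rescale φ τ G).coeff n = φ (G.coeff n) * τ ^ n := rfl

/-- Since τ ≠ 0 and φ is injective, supports are unchanged, so both Cauchy products run over the
same index pairs. -/
theorem rescale_mul {F : Type*} [Field F] (φ : F →+* K) {τ : K} (hτ : τ ≠ 0)
    (x y : LaurentSeries F) : rescale φ τ (x * y) = rescale φ τ x * rescale φ τ y := by
  have hs : ∀ x : LaurentSeries F, ∀ n : ℤ, n ∈ (rescale φ τ x).support ↔ n ∈ x.support := by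
    intro x n
    simp [zpow_ne_zero n hτ, rescale_coeff]
  ext n
  rw [rescale_coeff, HahnSeries.coeff_mul, HahnSeries.coeff_mul]
  simp only [map_sum, Finset.sum_mul, map_mul]
  refine Finset.sum_congr ?_ ?_
  · ext ⟨i, j⟩
    simp only [Finset.mem_antidiagonal, hs]
  · rintro ⟨i, j⟩ hij
    simp only [Finset.mem_antidiagonal] at hij
    rw [← hij.2.2, zpow_add₀ hτ, rescale_coeff, rescale_coeff]
    ring

/-- The ring homomorphism `∑ cₙ wⁿ ↦ ∑ φ(cₙ) τⁿ z^(An)`, i.e. the substitution `w = τ z^A`. -/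
noncomputable def twist {F : Type*} [Field F] (φ : F →+* K) (τ : K) (hτ : τ ≠ 0) (A : ℕ)
    (hA : 0 < A) : LaurentSeries F →+* LaurentSeries K :=
  (HahnSeries.embDomainRingHom (AddMonoidHom.mulLeft (A : ℤ))
    (fun x y h => by simpa [hA.ne'] using h)
    (fun x y => by simp [hA])).comp
  { toFun := rescale φ τ
    map_one' := by
      ext n
      by_cases h : n = 0 <;> simp [HahnSeries.coeff_one, h, rescale_coeff]
    map_zero' := by ext n; simp [rescale_coeff]
    map_add' := fun x y => by ext n; simp [add_mul, rescale_coeff]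
    map_mul' := rescale_mul φ hτ }

variable {F : Type*} [Field F] (φ : F →+* K) {τ : K} (hτ : τ ≠ 0) {A : ℕ} (hA : 0 < A)

theorem twist_coeff_mul (G : LaurentSeries F) (n : ℤ) :
    (twist φ τ hτ A hA G).coeff (A * n) = φ (G.coeff n) * τ ^ n := by
  simp only [twist, RingHom.comp_apply]
  exact HahnSeries.embDomain_coeff (f := ⟨⟨fun n : ℤ => (A : ℤ) * n, _⟩, _⟩) (a := n)

theorem twist_coeff_of_not_dvd (G : LaurentSeries F) {n : ℤ} (hn : ¬ (A : ℤ) ∣ n) :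
    (twist φ τ hτ A hA G).coeff n = 0 := by
  simp only [twist, RingHom.comp_apply]
  refine HahnSeries.embDomain_of_notMem_range (f := ⟨⟨fun n : ℤ => (A : ℤ) * n, _⟩, _⟩) ?_
  rintro ⟨m, rfl⟩
  exact hn (dvd_mul_right _ _)

theorem twist_coeff (G : LaurentSeries F) (n : ℤ) :
    (twist φ τ hτ A hA G).coeff n =
      if (A : ℤ) ∣ n then φ (G.coeff (n / A)) * τ ^ (n / (A : ℤ)) else 0 := by
  split_ifs with h
  · obtain ⟨m, rfl⟩ := h
    rw [twist_coeff_mul, Int.mul_ediv_cancel_left _ (by exact_mod_cast hA.ne')]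
  · exact twist_coeff_of_not_dvd φ hτ hA G h

theorem twist_single (e : ℤ) (x : F) :
    twist φ τ hτ A hA (single e x) = single (A * e) (φ x * τ ^ e) := by
  have hA' : (A : ℤ) ≠ 0 := by exact_mod_cast hA.ne'
  ext n
  rw [twist_coeff]
  split_ifs with h
  · obtain ⟨m, rfl⟩ := h
    rw [Int.mul_ediv_cancel_left _ hA']
    by_cases hm : m = e
    · simp [hm]
    · simp [hm, hA.ne']
  · rw [HahnSeries.coeff_single_of_ne]
    rintro rfl
    exact h (dvd_mul_right _ _)

end LaurentExpansion

/-! ### Coefficients of the symmetric expansion of f₀ -/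

section FZero

open HahnSeries

/-- The constant `t` in `ℚ(t)(z)`. -/
noncomputable abbrev tVar : RatFunc (RatFunc ℚ) := RatFunc.C (RatFunc.X : RatFunc ℚ)

theorem single_zpow {K : Type*} [Field K] (e : ℤ) {x : K} (n : ℤ) :
    (single e x : LaurentSeries K) ^ n = single (n * e) (x ^ n) := by
  cases n with
  | ofNat n => simp
  | negSucc n =>
    rw [zpow_negSucc, zpow_negSucc, HahnSeries.single_pow, HahnSeries.inv_single]
    congr 1
    rw [Int.negSucc_eq, nsmul_eq_mul]
    push_cast
    ring_nf

/-- Substituting w = z^A t⁻¹ commutes with expansion. The hypothesis on τ treats both expansions at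
once: at zero e = 1 and τ = t⁻¹; at infinity the local coordinate is z⁻¹, so e = -1 and τ = t. -/
theorem evalSingle_sub_zpow {e : ℤ} (he : e ≠ 0) {A : ℕ} (hA : 0 < A) {τ : RatFunc ℚ}
    (hτ : τ ≠ 0) (hτe : τ ^ e = (RatFunc.X)⁻¹) (d : ℤ) :
    evalSingle e he (((RatFunc.X : RatFunc (RatFunc ℚ)) ^ A * tVar⁻¹ -
      (RatFunc.X ^ A)⁻¹ * tVar) ^ d) =
    twist (RatFunc.C : ℚ →+* RatFunc ℚ) τ hτ A hA
      (evalSingle e he ((RatFunc.X - RatFunc.X⁻¹) ^ d)) := by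
  have hτe' : τ ^ (-e) = RatFunc.X := by rw [zpow_neg, hτe, inv_inv]
  simp only [map_zpow₀, map_sub, map_mul, map_inv₀, map_pow, evalSingle_X, evalSingle_C,
    HahnSeries.inv_single, HahnSeries.single_pow, HahnSeries.single_mul_single, twist_single]
  simp [hτe, hτe', mul_comm]

theorem single_sub_single_eq_sum {K : Type*} [Field K] (m : ℤ) (t : K) :
    (single m t⁻¹ - single (-m) t : LaurentSeries K) =
      ∑ u : ℤˣ, single ((u : ℤ) * m) (((u : ℤ) : K) * t ^ (-(u : ℤ))) := by
  have : (Finset.univ : Finset ℤˣ) = {1, -1} := rfl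
  rw [this, Finset.sum_pair (by decide)]
  simp [sub_eq_add_neg]

theorem prod_single {K ι : Type*} [Field K] (s : Finset ι) (m : ι → ℤ) (x : ι → K) :
    (∏ i ∈ s, single (m i) (x i) : LaurentSeries K) = single (∑ i ∈ s, m i) (∏ i ∈ s, x i) := by
  classical
  induction s using Finset.induction_on with
  | empty => simp
  | insert i s hi ih => simp [Finset.prod_insert hi, Finset.sum_insert hi, ih]

/-- Each factor is a sum over a sign u of u · z^(um) t^(-u); distributing the product gives a sum
over sign vectors. -/
theorem evalSingle_prod_sub {e : ℤ} (he : e ≠ 0) {k : ℕ} (m : Fin k → ℕ) :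
    evalSingle e he (∏ i, ((RatFunc.X : RatFunc (RatFunc ℚ)) ^ m i * tVar⁻¹ -
      (RatFunc.X ^ m i)⁻¹ * tVar)) =
    ∑ η : Fin k → ℤˣ, single (e * ∑ i, (η i : ℤ) * m i)
      (((∏ i, (η i : ℤ) : ℤ) : RatFunc ℚ) * RatFunc.X ^ (-∑ i, (η i : ℤ))) := by
  have h : ∀ i, evalSingle e he ((RatFunc.X : RatFunc (RatFunc ℚ)) ^ m i *
      tVar⁻¹ - (RatFunc.X ^ m i)⁻¹ * tVar) =
      ∑ u : ℤˣ, single ((u : ℤ) * (e * m i)) (((u : ℤ) : RatFunc ℚ) * RatFunc.X ^ (-(u : ℤ))) := by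
    intro i
    rw [← single_sub_single_eq_sum]
    simp [evalSingle_X, evalSingle_C, mul_comm]
  rw [map_prod, Finset.prod_congr rfl fun i _ => h i, Finset.prod_univ_sum, Fintype.piFinset_univ]
  refine Finset.sum_congr rfl fun η _ => ?_
  rw [prod_single, Finset.prod_mul_distrib, Finset.mul_sum]
  congr 2
  · exact Finset.sum_congr rfl fun i _ => by ring
  · push_cast
    rfl
  · rw [← Finset.sum_neg_distrib]
    induction (Finset.univ : Finset (Fin k)) using Finset.induction_on with
    | empty => simp
    | insert i s hi ih =>
      rw [Finset.prod_insert hi, Finset.sum_insert hi, ih, zpow_add₀ RatFunc.X_ne_zero]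

theorem fZero_eq {k : ℕ} (a : Fin k → ℕ) :
    fZero a = (∏ i, ((RatFunc.X : RatFunc (RatFunc ℚ)) ^ ((∏ j, a j) / a i) *
        tVar⁻¹ - (RatFunc.X ^ ((∏ j, a j) / a i))⁻¹ * tVar)) *
      (RatFunc.X ^ (∏ j, a j) * tVar⁻¹ -
        (RatFunc.X ^ (∏ j, a j))⁻¹ * tVar) ^ (2 - (k : ℤ)) := by
  rw [fZero, div_eq_mul_inv, ← zpow_neg, neg_sub]

theorem evalSingle_fZero_coeff {e : ℤ} (he : e ≠ 0) {k : ℕ} (a : Fin k → ℕ)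
    (hA : 0 < ∏ j, a j) {τ : RatFunc ℚ} (hτ : τ ≠ 0) (hτe : τ ^ e = (RatFunc.X)⁻¹) (n : ℤ) :
    (evalSingle e he (fZero a)).coeff n = ∑ η : Fin k → ℤˣ,
      ((∏ i, (η i : ℤ) : ℤ) : RatFunc ℚ) * RatFunc.X ^ (-∑ i, (η i : ℤ)) *
      (twist (RatFunc.C : ℚ →+* RatFunc ℚ) τ hτ (∏ j, a j) hA
        (evalSingle e he ((RatFunc.X - RatFunc.X⁻¹) ^ (2 - (k : ℤ))))).coeff
          (n - e * ∑ i, (η i : ℤ) * ((∏ j, a j) / a i : ℕ)) := by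
  rw [fZero_eq, map_mul, evalSingle_prod_sub, evalSingle_sub_zpow he hA hτ hτe, Finset.sum_mul,
    HahnSeries.coeff_sum]
  exact Finset.sum_congr rfl fun η _ => HahnSeries.coeff_single_mul

theorem symmetricExpansion_fZero {k : ℕ} (a : Fin k → ℕ) (hA : 0 < ∏ j, a j) (n : ℤ) :
    symmetricExpansion (fZero a) n = ∑ η : Fin k → ℤˣ,
      if ((∏ j, a j : ℕ) : ℤ) ∣ n - ∑ i, (η i : ℤ) * ((∏ j, a j) / a i : ℕ) then
        RatFunc.C ((∏ i, (η i : ℤ) : ℤ) * What k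
          (-((n - ∑ i, (η i : ℤ) * ((∏ j, a j) / a i : ℕ)) / (∏ j, a j : ℕ)))) *
        RatFunc.X ^ (-((n - ∑ i, (η i : ℤ) * ((∏ j, a j) / a i : ℕ)) / (∏ j, a j : ℕ)
          + ∑ i, (η i : ℤ)))
      else 0 := by
  have hX : (RatFunc.X : RatFunc ℚ) ≠ 0 := RatFunc.X_ne_zero
  rw [symmetricExpansion, laurentZero_eq, laurentInfty_eq,
    evalSingle_fZero_coeff one_ne_zero a hA (inv_ne_zero hX) (zpow_one _),
    evalSingle_fZero_coeff (by norm_num) a hA hX (zpow_neg_one _), Finset.sum_div, Finset.sum_div,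
    ← Finset.sum_add_distrib]
  refine Finset.sum_congr rfl fun η _ => ?_
  generalize ∑ i, (η i : ℤ) * ((∏ j, a j) / a i : ℕ) = σ
  generalize ∏ j, a j = A at *
  have hA' : (A : ℤ) ≠ 0 := by exact_mod_cast hA.ne'
  -- The coefficient of zⁿ at infinity is that of index -n in z⁻¹. After this both halves sit at ±(n
  -- - σ), so they recombine into one value of `What`.
  have h1 : -n - -1 * σ = -(n - σ) := by ring
  rw [one_mul, h1]
  generalize n - σ = N
  split_ifs with h
  · obtain ⟨m, rfl⟩ := h
    rw [← mul_neg, twist_coeff_mul, twist_coeff_mul, Int.mul_ediv_cancel_left _ hA', What,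
      symmetricExpansion, neg_neg, laurentZero_eq, laurentInfty_eq, neg_add, zpow_add₀ hX,
      inv_zpow, ← zpow_neg, map_mul, map_add, map_div₀, map_div₀, map_ofNat, map_intCast]
    ring
  · rw [twist_coeff_of_not_dvd _ _ _ _ h, twist_coeff_of_not_dvd _ _ _ _ (by rwa [dvd_neg])]
    simp

theorem symmetricExpansionCoeff_fZero {k : ℕ} (a : Fin k → ℕ) (hA : 0 < ∏ j, a j) (n m : ℤ) :
    symmetricExpansionCoeff (fZero a) n m = ∑ η : Fin k → ℤˣ,
      if ((∏ j, a j : ℕ) : ℤ) ∣ n - ∑ i, (η i : ℤ) * ((∏ j, a j) / a i : ℕ) ∧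
        m = -((n - ∑ i, (η i : ℤ) * ((∏ j, a j) / a i : ℕ)) / (∏ j, a j : ℕ) + ∑ i, (η i : ℤ)) then
        ((∏ i, (η i : ℤ) : ℤ) : ℚ) * What k
          (-((n - ∑ i, (η i : ℤ) * ((∏ j, a j) / a i : ℕ)) / (∏ j, a j : ℕ)))
      else 0 := by
  rw [symmetricExpansionCoeff, symmetricExpansion_fZero a hA, laurentZero_eq, map_sum,
    HahnSeries.coeff_sum]
  refine Finset.sum_congr rfl fun η _ => ?_
  by_cases h : ((∏ j, a j : ℕ) : ℤ) ∣ n - ∑ i, (η i : ℤ) * ((∏ j, a j) / a i : ℕ)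
  · rw [if_pos h, map_mul, map_zpow₀, evalSingle_C, evalSingle_X, Seifert.single_zpow,
      HahnSeries.single_mul_single, HahnSeries.coeff_single, zero_add, mul_one, one_zpow, mul_one]
    simp only [h, true_and]
    split_ifs <;> rfl
  · rw [if_neg h, if_neg (fun h' => h h'.1), map_zero, HahnSeries.coeff_zero]

end FZero

/-! ### Values and parity of the vertex weights -/

section WhatValues

open HahnSeries

theorem What_one (n : ℤ) : What 1 n = if n = 1 then -1 else if n = -1 then 1 else 0 := by
  rw [What, symmetricExpansion, laurentZero_eq, laurentInfty_eq]
  have h : (2 - ((1 : ℕ) : ℤ)) = 1 := by norm_num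
  rw [h, zpow_one]
  simp only [map_sub, map_inv₀, evalSingle_X, HahnSeries.inv_single, HahnSeries.coeff_sub,
    HahnSeries.coeff_single]
  split_ifs <;> first | omega | norm_num

theorem What_two (n : ℤ) : What 2 n = if n = 0 then 1 else 0 := by
  rw [What, symmetricExpansion, laurentZero_eq, laurentInfty_eq]
  have h : (2 - ((2 : ℕ) : ℤ)) = 0 := by norm_num
  rw [h, zpow_zero]
  simp only [map_one, HahnSeries.coeff_one]
  split_ifs <;> first | omega | norm_num

/-- The substitution z ↦ -z negates z - z⁻¹, hence multiplies its d-th power by (-1)^d, while it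
multiplies the n-th coefficient by (-1)^n. -/
theorem evalSingle_sub_zpow_coeff_eq_zero {e : ℤ} (he : e ≠ 0) (heo : Odd e) (d n : ℤ)
    (hn : Odd (n - d)) :
    (evalSingle e he (((RatFunc.X : RatFunc ℚ) - RatFunc.X⁻¹) ^ d)).coeff n = 0 := by
  set u : LaurentSeries ℚ := evalSingle e he (RatFunc.X - RatFunc.X⁻¹) with hu
  have h1 : rescale (RingHom.id ℚ) (-1) u = -u := by
    ext n
    rw [rescale_coeff, hu]
    simp only [map_sub, map_inv₀, evalSingle_X, HahnSeries.inv_single, HahnSeries.coeff_sub,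
      HahnSeries.coeff_neg, HahnSeries.coeff_single, RingHom.id_apply]
    by_cases h : n = e
    · subst h; simp [heo.neg_one_zpow]
    · by_cases h' : n = -e
      · subst h'; simp [heo.neg.neg_one_zpow]
      · simp [h, h']
  -- Rewriting as a `twist` with A = 1 supplies a field homomorphism, which commutes with negative
  -- powers too.
  have h2 : ∀ G : LaurentSeries ℚ, rescale (RingHom.id ℚ) (-1) G =
      twist (RingHom.id ℚ) (-1) (by norm_num) 1 one_pos G := by
    intro G
    ext n
    rw [twist_coeff, rescale_coeff]
    simp
  have h3 : rescale (RingHom.id ℚ) (-1) (u ^ d) = (-u) ^ d := by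
    rw [h2, map_zpow₀, ← h2, h1]
  rw [map_zpow₀, ← hu]
  have h4 := congrArg (fun G => G.coeff n) h3
  simp only [rescale_coeff, RingHom.id_apply] at h4
  rw [neg_eq_neg_one_mul u, mul_zpow] at h4
  have h5 : ((-1 : LaurentSeries ℚ) ^ d) = HahnSeries.C ((-1 : ℚ) ^ d) := by
    rw [map_zpow₀, map_neg, map_one]
  rw [h5, HahnSeries.C_mul_eq_smul, HahnSeries.coeff_smul, smul_eq_mul] at h4
  rcases Int.even_or_odd n with hn' | hn'
  · have : Odd d := by
      have := hn'.sub_odd hn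
      simpa using this
    rw [hn'.neg_one_zpow, this.neg_one_zpow] at h4
    linarith
  · have : Even d := by
      have := hn'.sub_odd hn
      simpa using this
    rw [hn'.neg_one_zpow, this.neg_one_zpow] at h4
    linarith

theorem What_eq_zero_of_odd (d : ℕ) (n : ℤ) (h : Odd (n - d)) : What d n = 0 := by
  rw [What, symmetricExpansion, laurentZero_eq, laurentInfty_eq,
    evalSingle_sub_zpow_coeff_eq_zero _ (by decide), evalSingle_sub_zpow_coeff_eq_zero _ (by decide)]
  · simp
  · obtain ⟨r, hr⟩ := h
    exact ⟨r + d - 1, by linarith⟩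
  · obtain ⟨r, hr⟩ := h
    exact ⟨-r - 2, by linarith⟩

end WhatValues

/-! ### Continuants and continued fractions -/

section Continuants

/-- The continuants of the tails of a list: `tailCont c j` is the continuant of `c.drop j` for
`j ≤ c.length`, and `0` for larger `j`. -/
def tailCont : List ℤ → ℕ → ℤ
  | [], 0 => 1
  | [], _ + 1 => 0
  | x :: l, 0 => x * tailCont l 0 - tailCont l 1
  | _ :: l, n + 1 => tailCont l n

theorem tailCont_length (c : List ℤ) : tailCont c c.length = 1 := by
  induction c with
  | nil => rfl
  | cons x l ih => exact ih

theorem tailCont_rec (c : List ℤ) (j : Fin c.length) :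
    tailCont c j = c.get j * tailCont c (j + 1) - tailCont c (j + 2) := by
  induction c with
  | nil => exact j.elim0
  | cons x l ih =>
    refine Fin.cases ?_ (fun i => ?_) j
    · simp [tailCont]
    · simpa [tailCont] using ih i

theorem isCoprime_tailCont (c : List ℤ) : IsCoprime (tailCont c 0) (tailCont c 1) := by
  induction c with
  | nil => exact isCoprime_one_left
  | cons x l ih =>
    simp only [tailCont]
    have := ih.symm.neg_left.add_mul_right_left x
    rwa [show -tailCont l 1 + x * tailCont l 0 = x * tailCont l 0 - tailCont l 1 by ring] at this

theorem contFrac_eq (c : List ℤ) (hc : c ≠ []) (h : ∀ j, 1 ≤ j → j ≤ c.length → tailCont c j ≠ 0) :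
    contFrac c = (tailCont c 0 : ℚ) / (tailCont c 1 : ℚ) := by
  induction c with
  | nil => exact absurd rfl hc
  | cons x l ih =>
    cases l with
    | nil => simp [contFrac, tailCont]
    | cons y l =>
      have h0 : (tailCont (y :: l) 0 : ℚ) ≠ 0 := by
        exact_mod_cast h 1 le_rfl (by simp)
      rw [contFrac, ih (by simp) fun j h1 h2 => h (j + 1) (by omega) (by simpa using h2), one_div_div]
      change _ = ((x * tailCont (y :: l) 0 - tailCont (y :: l) 1 : ℤ) : ℚ) / (tailCont (y :: l) 0 : ℚ)
      field_simp
      push_cast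
      ring

/-- Two reduced fractions with positive numerators and equal nonzero values coincide. -/
theorem eq_of_div_eq_div_of_isCoprime {a b p q : ℤ} (ha : 0 < a) (hp : 0 < p) (hq : 0 < q)
    (hab : IsCoprime a b) (hpq : IsCoprime p q) (h : (p : ℚ) / q = (a : ℚ) / b) :
    p = a ∧ q = b := by
  have hb : b ≠ 0 := by
    rintro rfl
    have : (0 : ℚ) < (p : ℚ) / q := div_pos (by exact_mod_cast hp) (by exact_mod_cast hq)
    rw [h] at this
    simp at this
  have h1 : p * b = a * q := by
    rw [div_eq_div_iff (by exact_mod_cast hq.ne') (by exact_mod_cast hb)] at h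
    exact_mod_cast h
  have h2 : p ∣ a := hpq.dvd_of_dvd_mul_right ⟨b, h1.symm⟩
  have h3 : a ∣ p := hab.dvd_of_dvd_mul_right ⟨q, h1⟩
  have h4 : p = a := Int.dvd_antisymm hp.le ha.le h2 h3
  refine ⟨h4, ?_⟩
  subst h4
  exact (mul_left_cancel₀ ha.ne' h1).symm

/-- The continuants of the initial segments of a list, shifted by one: `headCont c 0 = 0`,
`headCont c 1 = 1`, and `headCont c (j + 1)` is the continuant of `c.take j`. -/
def headCont (c : List ℤ) : ℕ → ℤ
  | 0 => 0
  | 1 => 1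
  | j + 2 => c.getD j 0 * headCont c (j + 1) - headCont c j

end Continuants

/-! ### The plumbing matrix of a star as a recurrence along the legs -/

section StarMatrix

variable {k : ℕ} (b : ℤ) (c : Fin k → List ℤ)

/-- The values of a vector along the `i`-th leg, with the value at the centre first. -/
def alongLeg (x : StarVertex c → ℤ) (i : Fin k) : ℕ → ℤ
  | 0 => x none
  | j + 1 => if h : j < (c i).length then x (some ⟨i, ⟨j, h⟩⟩) else 0

theorem starPlumbing_adj_none_some (i : Fin k) (j : Fin (c i).length) :
    (starPlumbing b c).graph.Adj none (some ⟨i, j⟩) ↔ j.1 = 0 := by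
  simp [starPlumbing, starEdge]

theorem starPlumbing_adj_some_none (i : Fin k) (j : Fin (c i).length) :
    (starPlumbing b c).graph.Adj (some ⟨i, j⟩) none ↔ j.1 = 0 := by
  simp [starPlumbing, starEdge]

theorem starPlumbing_adj_some_some (i i' : Fin k) (j : Fin (c i).length) (j' : Fin (c i').length) :
    (starPlumbing b c).graph.Adj (some ⟨i, j⟩) (some ⟨i', j'⟩) ↔
      i = i' ∧ (j'.1 = j.1 + 1 ∨ j.1 = j'.1 + 1) := by
  simp only [starPlumbing, SimpleGraph.fromRel_adj, starEdge, ne_eq, Option.some.injEq]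
  constructor
  · rintro ⟨-, ⟨h1, h2⟩ | ⟨h1, h2⟩⟩
    · exact ⟨h1, Or.inl h2⟩
    · exact ⟨h1.symm, Or.inr h2⟩
  · rintro ⟨rfl, h⟩
    refine ⟨?_, ?_⟩
    · intro h'
      have : j = j' := by simpa using h'
      subst this
      omega
    · simpa using h

theorem matrix_none_none : (starPlumbing b c).matrix none none = -b := by
  simp [Plumbing.matrix, starPlumbing]

theorem matrix_none_some (i : Fin k) (j : Fin (c i).length) :
    (starPlumbing b c).matrix none (some ⟨i, j⟩) = if j.1 = 0 then 1 else 0 := by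
  simp [Plumbing.matrix, starPlumbing_adj_none_some]

theorem matrix_some_none (i : Fin k) (j : Fin (c i).length) :
    (starPlumbing b c).matrix (some ⟨i, j⟩) none = if j.1 = 0 then 1 else 0 := by
  simp [Plumbing.matrix, starPlumbing_adj_some_none]

theorem matrix_some_some_same (i : Fin k) (j j' : Fin (c i).length) :
    (starPlumbing b c).matrix (some ⟨i, j⟩) (some ⟨i, j'⟩) =
      if j = j' then -((c i).get j) else if j'.1 = j.1 + 1 ∨ j.1 = j'.1 + 1 then 1 else 0 := by
  simp only [Plumbing.matrix, Matrix.of_apply, starPlumbing_adj_some_some]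
  by_cases h : j = j'
  · subst h; simp [starPlumbing]
  · have : ¬ (some (⟨i, j⟩ : Σ i : Fin k, Fin (c i).length) = some ⟨i, j'⟩) := by simpa using h
    simp [h]

theorem matrix_some_some_of_ne {i i' : Fin k} (h : i ≠ i') (j : Fin (c i).length)
    (j' : Fin (c i').length) :
    (starPlumbing b c).matrix (some ⟨i, j⟩) (some ⟨i', j'⟩) = 0 := by
  simp [Plumbing.matrix, starPlumbing_adj_some_some, h]

theorem matrix_mulVec_none (x : StarVertex c → ℤ) :
    ((starPlumbing b c).matrix *ᵥ x) none = -b * x none + ∑ i, alongLeg c x i 1 := by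
  rw [Matrix.mulVec, dotProduct, Fintype.sum_option, Fintype.sum_sigma, matrix_none_none]
  congr 1
  refine Finset.sum_congr rfl fun i _ => ?_
  simp only [matrix_none_some, ite_mul, one_mul, zero_mul, alongLeg]
  split_ifs with h
  · rw [Finset.sum_eq_single ⟨0, h⟩] <;> simp +contextual [Fin.ext_iff]
  · exact Finset.sum_eq_zero fun j _ => absurd j.2 (by omega)

theorem sum_fin_ite_eq {n : ℕ} (x : Fin n → ℤ) (m : ℕ) :
    ∑ j : Fin n, (if j.1 = m then x j else 0) = if h : m < n then x ⟨m, h⟩ else 0 := by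
  split_ifs with h
  · rw [Finset.sum_eq_single ⟨m, h⟩] <;> simp +contextual [Fin.ext_iff]
  · exact Finset.sum_eq_zero fun j _ => if_neg (by omega)

/-- In `alongLeg` the centre has index 0, so vertex (i, j) has index j + 1. The value 0 past the end
makes the three-term formula valid at the last vertex as well. -/
theorem matrix_mulVec_some (x : StarVertex c → ℤ) (i : Fin k) (j : Fin (c i).length) :
    ((starPlumbing b c).matrix *ᵥ x) (some ⟨i, j⟩) =
      alongLeg c x i j - (c i).get j * alongLeg c x i (j + 1) + alongLeg c x i (j + 2) := by
  rw [Matrix.mulVec, dotProduct, Fintype.sum_option, Fintype.sum_sigma, matrix_some_none,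
    Finset.sum_eq_single i (fun i' _ h => Finset.sum_eq_zero fun j' _ => by
      rw [matrix_some_some_of_ne b c (Ne.symm h), zero_mul]) (by simp)]
  have h : ∀ j' : Fin (c i).length,
      (starPlumbing b c).matrix (some ⟨i, j⟩) (some ⟨i, j'⟩) * x (some ⟨i, j'⟩) =
      (if j'.1 = j.1 then -((c i).get j) * x (some ⟨i, j'⟩) else 0) +
      (if j'.1 = j.1 + 1 then x (some ⟨i, j'⟩) else 0) +
      (if j.1 = 0 then 0 else if j'.1 = j.1 - 1 then x (some ⟨i, j'⟩) else 0) := by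
    intro j'
    rw [matrix_some_some_same]
    simp only [Fin.ext_iff]
    split_ifs <;> omega
  simp only [h, Finset.sum_add_distrib, sum_fin_ite_eq]
  obtain ⟨j, hj⟩ := j
  cases j with
  | zero => simp [alongLeg, hj]; ring
  | succ j =>
    have : j < (c i).length := by omega
    simp [alongLeg, hj, this, sum_fin_ite_eq]; ring

end StarMatrix

/-! ### Negative definiteness over ℚ and ℤ -/

section NegDefForm

variable {V : Type*} [Fintype V] [DecidableEq V] {Γ : Plumbing V}

theorem Plumbing.NegDef.rat_form_neg (h : Γ.NegDef) {x : V → ℚ} (hx : x ≠ 0) :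
    x ⬝ᵥ ((Γ.matrix.map (Int.cast : ℤ → ℚ)) *ᵥ x) < 0 := by
  have h1 := h.dotProduct_mulVec_pos (x := fun v => (x v : ℝ)) (by
    intro h0
    apply hx
    funext v
    simpa using congrFun h0 v)
  have h2 : star (fun v => (x v : ℝ)) ⬝ᵥ
      (-(Γ.matrix.map (Int.cast : ℤ → ℝ)) *ᵥ fun v => (x v : ℝ)) =
      ((-(x ⬝ᵥ ((Γ.matrix.map (Int.cast : ℤ → ℚ)) *ᵥ x)) : ℚ) : ℝ) := by
    simp [dotProduct, Matrix.mulVec]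
  rw [h2] at h1
  have h3 : 0 < -(x ⬝ᵥ ((Γ.matrix.map (Int.cast : ℤ → ℚ)) *ᵥ x)) := by exact_mod_cast h1
  linarith

theorem Plumbing.NegDef.form_neg (h : Γ.NegDef) {x : V → ℤ} (hx : x ≠ 0) : Γ.form x x < 0 := by
  have h1 := h.rat_form_neg (x := fun v => (x v : ℚ)) (by
    intro h0
    apply hx
    funext v
    simpa using congrFun h0 v)
  rw [← Plumbing.cast_mulVec] at h1
  have h2 : ((Γ.form x x : ℤ) : ℚ) < 0 := by
    convert h1 using 1
    simp [Plumbing.form, dotProduct]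
  exact_mod_cast h2

end NegDefForm

/-- A matrix that is triangular for an injective ranking of the indices. -/
theorem det_eq_prod_diag_of_rank {m α R : Type*} [Fintype m] [DecidableEq m] [LinearOrder α]
    [CommRing R] (ρ : m → α) (hρ : Function.Injective ρ) (M : Matrix m m R)
    (h : ∀ i j, ρ j < ρ i → M i j = 0) : M.det = ∏ i, M i i := by
  let _ : LinearOrder m := LinearOrder.lift' ρ hρ
  convert Matrix.det_of_isUpperTriangular (M := M) (fun i j hij => h i j hij) using 2

/-! ### Positivity of continuants and the determinant of a star -/

section StarDeterminant

variable {k : ℕ} (b : ℤ) (c : Fin k → List ℤ)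

theorem tailCont_of_length_lt (l : List ℤ) {n : ℕ} (h : l.length < n) : tailCont l n = 0 := by
  induction l generalizing n with
  | nil =>
    cases n with
    | zero => simp at h
    | succ n => rfl
  | cons x l ih =>
    cases n with
    | zero => simp at h
    | succ n => exact ih (by simpa using h)

/-- The vector of the tail continuants on the vertices `(i, j)`, `m ≤ j`, of the `i`-th leg. -/
def tailVec (i : Fin k) (m : ℕ) : StarVertex c → ℤ
  | none => 0
  | some ⟨i', j⟩ => if i' = i ∧ m ≤ j then tailCont (c i') (j + 1) else 0

theorem alongLeg_tailVec (i i' : Fin k) (m n : ℕ) :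
    alongLeg c (tailVec c i m) i' n = if i' = i ∧ m + 1 ≤ n then tailCont (c i') n else 0 := by
  cases n with
  | zero => simp [alongLeg, tailVec]
  | succ n =>
    simp only [alongLeg, tailVec, Nat.add_le_add_iff_right]
    split_ifs with h1 h2 h2
    · rfl
    · rfl
    · exact (tailCont_of_length_lt _ (by omega)).symm
    · rfl

theorem matrix_mulVec_tailVec_some (i i' : Fin k) (m : ℕ) (j : Fin (c i').length) :
    ((starPlumbing b c).matrix *ᵥ tailVec c i m) (some ⟨i', j⟩) =
      if i' = i ∧ j.1 = m then -tailCont (c i') m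
      else if i' = i ∧ j.1 + 1 = m then tailCont (c i') (m + 1) else 0 := by
  rw [matrix_mulVec_some]
  simp only [alongLeg_tailVec]
  have hr := tailCont_rec (c i') j
  by_cases hi : i' = i
  · subst hi
    simp only [true_and]
    rcases lt_trichotomy j.1 m with h | rfl | h
    · by_cases h' : j.1 + 1 = m
      · subst h'; simp
      · simp [h', h.ne, show ¬ m ≤ j.1 by omega, show ¬ m + 1 ≤ j.1 by omega,
          show ¬ m + 1 ≤ j.1 + 2 by omega]
    · rw [hr]; simp; ring
    · rw [if_pos (by omega), if_pos (by omega), if_pos (by omega), if_neg (by omega),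
        if_neg (by omega)]
      linarith
  · simp [hi]

/-- By the continuant recurrence, M times the tail vector lives only at the m-th vertex of the leg
and its inner neighbour; the vector itself vanishes at the latter. -/
theorem form_tailVec (i : Fin k) (m : ℕ) (hm : m < (c i).length) :
    (starPlumbing b c).form (tailVec c i m) (tailVec c i m) =
      -(tailCont (c i) m * tailCont (c i) (m + 1)) := by
  rw [Plumbing.form, dotProduct, Finset.sum_eq_single (some ⟨i, ⟨m, hm⟩⟩)]
  · rw [matrix_mulVec_tailVec_some]
    simp [tailVec]
    ring
  · rintro (_ | ⟨i', j⟩) - h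
    · simp [tailVec]
    · rw [matrix_mulVec_tailVec_some]
      simp only [tailVec]
      by_cases hi : i' = i
      · subst hi
        have : j.1 ≠ m := by
          rintro rfl
          exact h rfl
        by_cases h' : m ≤ j.1
        · simp [this, show ¬ j.1 + 1 = m by omega]
        · simp [h']
      · simp [hi]
  · simp

variable {b c}

/-- Consecutive continuants have positive product by `form_tailVec` and negative definiteness, and
the last one is 1; induct inwards from the end. -/
theorem tailCont_pos (hneg : (starPlumbing b c).NegDef) (i : Fin k) {m : ℕ}
    (hm : m ≤ (c i).length) : 0 < tailCont (c i) m := by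
  induction hm using Nat.decreasingInduction with
  | self => rw [tailCont_length]; exact one_pos
  | of_succ m hm ih =>
    have h := hneg.form_neg (x := tailVec c i m) (by
      intro h0
      have := congrFun h0 (some ⟨i, ⟨m, hm⟩⟩)
      simp only [tailVec, le_refl, and_self, if_true, Pi.zero_apply] at this
      exact ih.ne' this)
    rw [form_tailVec b c i m hm] at h
    nlinarith

/-- Both sides are numerators of the same reduced fraction; positivity removes the sign ambiguity.
-/
theorem tailCont_eq (hneg : (starPlumbing b c).NegDef) {a : Fin k → ℕ} {β : Fin k → ℤ}
    (ha : ∀ i, 0 < a i) (hcop : ∀ i, IsCoprime (a i : ℤ) (β i)) (hc : ∀ i, c i ≠ [])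
    (hcf : ∀ i, contFrac (c i) = (a i : ℚ) / (β i : ℚ)) (i : Fin k) :
    tailCont (c i) 0 = a i := by
  have h1 : 1 ≤ (c i).length := List.length_pos_of_ne_nil (hc i)
  have := contFrac_eq (c i) (hc i) fun j _ hj => (tailCont_pos hneg i hj).ne'
  rw [hcf i] at this
  exact (eq_of_div_eq_div_of_isCoprime (by exact_mod_cast ha i)
    (tailCont_pos hneg i (Nat.zero_le _)) (tailCont_pos hneg i h1) (hcop i)
    (isCoprime_tailCont _) (by rw [← this]; simp)).1

variable (b c)

/-- The vector proportional to the central column of the inverse plumbing matrix, with values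
`A` at the centre and `p i * tailCont (c i) (j + 1)` at `(i, j)`. -/
def centerVec (A : ℤ) (p : Fin k → ℤ) : StarVertex c → ℤ
  | none => A
  | some ⟨i, j⟩ => p i * tailCont (c i) (j + 1)

variable {A : ℤ} {p : Fin k → ℤ}

theorem alongLeg_centerVec (hp : ∀ i, tailCont (c i) 0 * p i = A) (i : Fin k) (n : ℕ) :
    alongLeg c (centerVec c A p) i n = p i * tailCont (c i) n := by
  cases n with
  | zero => rw [alongLeg, centerVec, ← hp i, mul_comm]
  | succ n =>
    simp only [alongLeg, centerVec]
    split_ifs with h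
    · rfl
    · rw [tailCont_of_length_lt _ (by omega), mul_zero]

/-- The product of `A` and the orbifold Euler number, up to sign the determinant of the star. -/
def starDet (A : ℤ) (p : Fin k → ℤ) : ℤ := b * A - ∑ i, p i * tailCont (c i) 1

theorem matrix_mulVec_centerVec (hp : ∀ i, tailCont (c i) 0 * p i = A) :
    (starPlumbing b c).matrix *ᵥ centerVec c A p = Pi.single none (-starDet b c A p) := by
  funext v
  rcases v with _ | ⟨i, j⟩
  · rw [matrix_mulVec_none]
    simp only [alongLeg_centerVec c hp, centerVec, starDet, Pi.single_eq_same]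
    ring
  · rw [matrix_mulVec_some]
    simp only [alongLeg_centerVec c hp, tailCont_rec (c i) j]
    simp
    ring

/-- A ranking of the vertices, increasing away from the centre. -/
def vertexRank : StarVertex c → ℕ ×ₗ ℕ
  | none => toLex (0, 0)
  | some ⟨i, j⟩ => toLex (i + 1, j)

theorem vertexRank_injective : Function.Injective (vertexRank c) := by
  rintro (_ | ⟨i, j⟩) (_ | ⟨i', j'⟩) h
  · rfl
  · simp [vertexRank] at h
  · simp [vertexRank] at h
  · simp only [vertexRank, EmbeddingLike.apply_eq_iff_eq, Prod.mk.injEq, add_left_inj,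
      Fin.val_inj] at h
    obtain ⟨rfl, h⟩ := h
    rw [Fin.ext h]

/-- The columns of a triangular matrix that triangularizes the matrix of the star. -/
def elimMatrix (A : ℤ) (p : Fin k → ℤ) : Matrix (StarVertex c) (StarVertex c) ℤ :=
  Matrix.of fun v w => match w with
    | none => centerVec c A p v
    | some ⟨i, m⟩ => tailVec c i m v

theorem det_elimMatrix (A : ℤ) (p : Fin k → ℤ) :
    (elimMatrix c A p).det = A * ∏ i, ∏ j : Fin (c i).length, tailCont (c i) (j + 1) := by
  rw [← Matrix.det_transpose, det_eq_prod_diag_of_rank _ (vertexRank_injective c),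
    Fintype.prod_option, Fintype.prod_sigma]
  · simp [elimMatrix, centerVec, tailVec]
  · rintro (_ | ⟨i, j⟩) (_ | ⟨i', j'⟩) h
    · simp at h
    · exact absurd h (by simp [vertexRank, Prod.Lex.toLex_lt_toLex])
    · simp [elimMatrix, tailVec]
    · simp only [vertexRank, Prod.Lex.toLex_lt_toLex, add_lt_add_iff_right, add_left_inj,
        Fin.val_inj] at h
      simp only [elimMatrix, Matrix.transpose_apply, Matrix.of_apply, tailVec]
      refine if_neg ?_
      rintro ⟨rfl, h2⟩
      simp at h
      exact absurd h2 (by simpa using h)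

/-- M times the central column is supported at the centre, and M times the column of (i, m) reaches
only (i, m) and its inner neighbour, so the product is triangular for a ranking increasing outwards.
-/
theorem det_matrix_mul_elimMatrix (hp : ∀ i, tailCont (c i) 0 * p i = A) :
    ((starPlumbing b c).matrix * elimMatrix c A p).det =
      -starDet b c A p * ∏ i, ∏ j : Fin (c i).length, -tailCont (c i) j := by
  have hnone : ∀ v, ((starPlumbing b c).matrix * elimMatrix c A p) v none =
      (Pi.single none (-starDet b c A p) : StarVertex c → ℤ) v := by
    intro v
    rw [← matrix_mulVec_centerVec b c hp]
    rfl
  have hsome : ∀ v i m, ((starPlumbing b c).matrix * elimMatrix c A p) v (some ⟨i, m⟩) =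
      ((starPlumbing b c).matrix *ᵥ tailVec c i m) v := fun v i m => rfl
  rw [det_eq_prod_diag_of_rank _ (vertexRank_injective c), Fintype.prod_option, Fintype.prod_sigma]
  · simp only [hnone, hsome, matrix_mulVec_tailVec_some]
    simp
  · rintro (_ | ⟨i, j⟩) (_ | ⟨i', j'⟩) h
    · simp at h
    · exact absurd h (by simp [vertexRank, Prod.Lex.toLex_lt_toLex])
    · simp [hnone]
    · simp only [vertexRank, Prod.Lex.toLex_lt_toLex, add_lt_add_iff_right, add_left_inj,
        Fin.val_inj] at h
      rw [hsome, matrix_mulVec_tailVec_some]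
      by_cases hi : i = i'
      · subst hi
        simp at h
        have : j'.1 < j.1 := h
        rw [if_neg (by omega), if_neg (by omega)]
      · simp [hi]

variable {b c}

theorem starDet_pos (hneg : (starPlumbing b c).NegDef) (hp : ∀ i, tailCont (c i) 0 * p i = A)
    (hA : 0 < A) : 0 < starDet b c A p := by
  have h := hneg.form_neg (x := centerVec c A p) (by
    intro h0
    exact hA.ne' (congrFun h0 none))
  rw [Plumbing.form, matrix_mulVec_centerVec b c hp, dotProduct_single, centerVec] at h
  nlinarith

theorem det_matrix (hneg : (starPlumbing b c).NegDef) (hp : ∀ i, tailCont (c i) 0 * p i = A)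
    (hA : A = ∏ i, tailCont (c i) 0) :
    (starPlumbing b c).matrix.det = (-1) ^ Fintype.card (StarVertex c) * starDet b c A p := by
  have h := det_matrix_mul_elimMatrix b c hp
  rw [Matrix.det_mul, det_elimMatrix] at h
  have hA0 : 0 < A := by
    rw [hA]
    exact Finset.prod_pos fun i _ => tailCont_pos hneg i (Nat.zero_le _)
  -- Shifting the index by one along a leg trades the first continuant for the last, which is 1.
  have hP : (∏ i, ∏ j : Fin (c i).length, tailCont (c i) j) =
      A * ∏ i, ∏ j : Fin (c i).length, tailCont (c i) (j + 1) := by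
    rw [hA, ← Finset.prod_mul_distrib]
    refine Finset.prod_congr rfl fun i _ => ?_
    have h1 := Fin.prod_univ_succ fun j : Fin ((c i).length + 1) => tailCont (c i) j
    have h2 := Fin.prod_univ_castSucc fun j : Fin ((c i).length + 1) => tailCont (c i) j
    simp only [Fin.val_castSucc, Fin.val_last, tailCont_length, mul_one] at h2
    rw [← h2, h1]
    simp
  have hpos : (A * ∏ i, ∏ j : Fin (c i).length, tailCont (c i) (j + 1)) ≠ 0 := by
    refine (mul_pos hA0 (Finset.prod_pos fun i _ => Finset.prod_pos fun j _ => ?_)).ne'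
    exact tailCont_pos hneg i j.2
  simp only [Finset.prod_neg, Finset.prod_mul_distrib, hP] at h
  apply mul_right_cancel₀ hpos
  rw [h, Finset.prod_pow_eq_pow_sum]
  simp only [Finset.card_univ, Fintype.card_fin, Fintype.card_option, Fintype.card_sigma]
  ring

end StarDeterminant

/-! ### Order of H and the inverse of the plumbing matrix -/

section PlumbingInverse

variable {V : Type*} [Fintype V] [DecidableEq V] {Γ : Plumbing V}

theorem Plumbing.NegDef.det_ne_zero (h : Γ.NegDef) : Γ.matrix.det ≠ 0 := by
  intro h0
  have h1 := h.isUnit_det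
  rw [← Int.cast_det, h0] at h1
  simp at h1

theorem Plumbing.natCard_H1 (Γ : Plumbing V) (h : Γ.matrix.det ≠ 0) :
    Nat.card Γ.H1 = Γ.matrix.det.natAbs := by
  have hinj : Function.Injective Γ.matrix.mulVecLin :=
    Matrix.mulVec_injective_of_det_ne_zero h
  rw [← Submodule.natAbs_det_equiv _ (LinearEquiv.ofInjective _ hinj)]
  congr 1
  rw [← LinearMap.det_toLin']
  rfl

theorem Plumbing.NegDef.dotProduct_inv_mulVec (h : Γ.NegDef) (x : V → ℤ) (y : V → ℚ) :
    (fun v => (((Γ.matrix *ᵥ x) v : ℤ) : ℚ)) ⬝ᵥ ((Γ.matrix.map (Int.cast : ℤ → ℚ))⁻¹ *ᵥ y) =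
      (fun v => (x v : ℚ)) ⬝ᵥ y := by
  have hT : (Γ.matrix.map (Int.cast : ℤ → ℚ))ᵀ = Γ.matrix.map (Int.cast : ℤ → ℚ) := by
    rw [← Matrix.transpose_map, Plumbing.matrix_transpose]
  rw [Plumbing.cast_mulVec, ← Matrix.vecMul_transpose, hT, ← Matrix.dotProduct_mulVec,
    Matrix.mulVec_mulVec, Matrix.mul_nonsing_inv _ h.isUnit_det, Matrix.one_mulVec]

theorem Plumbing.NegDef.cast_adjugate_diag (h : Γ.NegDef) (v : V) :
    ((Γ.matrix.adjugate v v : ℤ) : ℚ) = Γ.matrix.det * Γ.invSq (Pi.single v 1) := by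
  have h1 : (fun w => ((Pi.single v 1 : V → ℤ) w : ℚ)) = Pi.single v 1 := by
    funext w
    by_cases hw : w = v
    · subst hw; simp
    · simp [hw]
  have h2 : (Γ.matrix.map (Int.cast : ℤ → ℚ)).det = Γ.matrix.det := by
    rw [Int.cast_det]
  have h3 : (Γ.matrix.map (Int.cast : ℤ → ℚ)).adjugate = Γ.matrix.adjugate.map Int.cast := by
    simpa using ((Int.castRingHom ℚ).map_adjugate Γ.matrix).symm
  rw [Plumbing.invSq, h1, Matrix.mulVec_single_one, single_one_dotProduct, Matrix.inv_def, h2, h3,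
    Matrix.col_apply, Matrix.smul_apply, Ring.inverse_eq_inv', Matrix.map_apply, smul_eq_mul,
    mul_inv_cancel_left₀ (by exact_mod_cast h.det_ne_zero)]

end PlumbingInverse

/-! ### The inverse form on vectors supported at the centre and the ends -/

section StarInverse

variable {k : ℕ} (b : ℤ) (c : Fin k → List ℤ)

/-- The vector of the head continuants on the `i`-th leg. -/
def headVec (i : Fin k) : StarVertex c → ℤ
  | none => 0
  | some ⟨i', j⟩ => if i' = i then headCont (c i') (j + 1) else 0

theorem alongLeg_headVec (i i' : Fin k) (n : ℕ) :
    alongLeg c (headVec c i) i' n =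
      if i' = i ∧ n ≤ (c i').length then headCont (c i') n else 0 := by
  cases n with
  | zero => simp [alongLeg, headVec, headCont]
  | succ n =>
    simp only [alongLeg, headVec, Nat.succ_le_iff]
    split_ifs <;> first | rfl | omega

theorem headCont_rec (l : List ℤ) (j : Fin l.length) :
    headCont l (j + 2) = l.get j * headCont l (j + 1) - headCont l j := by
  rw [headCont, List.getD_eq_getElem _ _ j.2]
  rfl

/-- The head continuants satisfy the recurrence of the leg from the centre outwards; the defects are
the value 1 seen at the centre and the missing next term at the end. -/
theorem matrix_mulVec_headVec (hc : ∀ i, c i ≠ []) (i : Fin k) :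
    (starPlumbing b c).matrix *ᵥ headVec c i =
      Pi.single none 1 - Pi.single (leaf c hc i) (headCont (c i) ((c i).length + 1)) := by
  have hlen : ∀ i, 1 ≤ (c i).length := fun i => List.length_pos_of_ne_nil (hc i)
  funext v
  rcases v with _ | ⟨i', j⟩
  · rw [matrix_mulVec_none]
    simp [alongLeg_headVec, headVec, hlen, leaf, headCont]
  · rw [matrix_mulVec_some]
    simp only [alongLeg_headVec]
    by_cases hi : i' = i
    · subst hi
      have hr := headCont_rec (c i') j
      have hj := j.2
      by_cases h : j.1 + 1 = (c i').length
      · have hv : (some ⟨i', j⟩ : StarVertex c) = leaf c hc i' := by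
          simp only [leaf, Option.some.injEq, Sigma.mk.injEq, heq_eq_eq, true_and, Fin.ext_iff]
          omega
        have hlast : headCont (c i') ((c i').length + 1) = headCont (c i') (j + 2) :=
          congrArg _ (by omega)
        rw [if_pos ⟨rfl, by omega⟩, if_pos ⟨rfl, by omega⟩, if_neg (by omega), hlast, hr,
          Pi.sub_apply, ← hv, Pi.single_eq_same, Pi.single_eq_of_ne (by simp)]
        ring
      · have hv : (some ⟨i', j⟩ : StarVertex c) ≠ leaf c hc i' := by
          simp only [leaf, ne_eq, Option.some.injEq, Sigma.mk.injEq, heq_eq_eq, true_and,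
            Fin.ext_iff]
          omega
        rw [if_pos ⟨rfl, by omega⟩, if_pos ⟨rfl, by omega⟩, if_pos ⟨rfl, by omega⟩, hr,
          Pi.sub_apply, Pi.single_eq_of_ne hv, Pi.single_eq_of_ne (by simp)]
        ring
    · simp [hi, leaf]

variable {c} in
theorem headVec_leaf (hc : ∀ i, c i ≠ []) (i i' : Fin k) :
    headVec c i (leaf c hc i') = if i' = i then headCont (c i') (c i').length else 0 := by
  have hlen : 1 ≤ (c i').length := List.length_pos_of_ne_nil (hc i')
  simp [headVec, leaf, Nat.sub_add_cancel hlen]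

variable {c} in
theorem tailVec_leaf (hc : ∀ i, c i ≠ []) (i : Fin k) : tailVec c i 0 (leaf c hc i) = 1 := by
  have hlen : 1 ≤ (c i).length := List.length_pos_of_ne_nil (hc i)
  simp [tailVec, leaf, Nat.sub_add_cancel hlen, tailCont_length]

variable {c} in
theorem centerVec_leaf (hc : ∀ i, c i ≠ []) (A : ℤ) (p : Fin k → ℤ) (i : Fin k) :
    centerVec c A p (leaf c hc i) = p i := by
  have hlen : 1 ≤ (c i).length := List.length_pos_of_ne_nil (hc i)
  simp [centerVec, leaf, Nat.sub_add_cancel hlen, tailCont_length]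

/-- Continuants are invariant under reversal. -/
theorem headCont_length_succ (hc : ∀ i, c i ≠ []) (i : Fin k) :
    headCont (c i) ((c i).length + 1) = tailCont (c i) 0 := by
  have hlen : 0 < (c i).length := List.length_pos_of_ne_nil (hc i)
  -- Symmetry of M, evaluated on the tail and head vectors, gives the identity. Both vanish at the
  -- centre, so the central weight may be taken to be 0.
  have h := (starPlumbing 0 c).dotProduct_mulVec_comm (tailVec c i 0) (headVec c i)
  have h1 : (starPlumbing 0 c).matrix *ᵥ tailVec c i 0 =
      Pi.single none (tailCont (c i) 1) + Pi.single (some ⟨i, ⟨0, hlen⟩⟩) (-tailCont (c i) 0) := by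
    funext v
    rcases v with _ | ⟨i', j⟩
    · rw [matrix_mulVec_none]
      simp [alongLeg_tailVec, tailVec]
    · rw [matrix_mulVec_tailVec_some]
      by_cases hi : i' = i
      · subst hi
        by_cases hj : j.1 = 0
        · have : j = ⟨0, hlen⟩ := Fin.ext hj
          subst this
          simp
        · have : j ≠ ⟨0, hlen⟩ := fun h => hj (congrArg Fin.val h)
          simp [hj, this]
      · have : (some ⟨i', j⟩ : StarVertex c) ≠ some ⟨i, ⟨0, hlen⟩⟩ := by
          intro h
          simp only [Option.some.injEq, Sigma.mk.injEq] at h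
          exact hi h.1
        simp [hi, this]
  rw [matrix_mulVec_headVec 0 c hc, h1, dotProduct_sub, dotProduct_add, dotProduct_single,
    dotProduct_single, dotProduct_single, dotProduct_single, tailVec_leaf] at h
  simp [tailVec, headVec, headCont] at h
  exact h

/-- The vector with value `n` at the centre, `ε i` at the end of the `i`-th leg and `0` at the
other vertices. -/
def endVec (hc : ∀ i, c i ≠ []) (n : ℤ) (ε : Fin k → ℤ) : StarVertex c → ℤ :=
  Pi.single none n + ∑ i, Pi.single (leaf c hc i) (ε i)

variable {b c}

theorem cast_endVec_dotProduct (hc : ∀ i, c i ≠ []) (n : ℤ) (ε : Fin k → ℤ)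
    (x : StarVertex c → ℚ) :
    (fun v => (endVec c hc n ε v : ℚ)) ⬝ᵥ x = n * x none + ∑ i, ε i * x (leaf c hc i) := by
  have : (fun v => (endVec c hc n ε v : ℚ)) =
      Pi.single none (n : ℚ) + ∑ i, Pi.single (leaf c hc i) (ε i : ℚ) := by
    funext v
    simp only [endVec, Pi.add_apply, Finset.sum_apply, Int.cast_add, Int.cast_sum]
    congr 1
    · exact Pi.apply_single (fun _ (z : ℤ) => (z : ℚ)) (fun _ => Int.cast_zero) _ _ _
    · exact Finset.sum_congr rfl fun i _ =>
        Pi.apply_single (fun _ (z : ℤ) => (z : ℚ)) (fun _ => Int.cast_zero) _ _ _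
  rw [this, add_dotProduct, single_dotProduct, sum_dotProduct]
  simp only [single_dotProduct]

/-- Only the entries of g = M⁻¹l at the centre and the ends matter. Pairing l with the centre vector
determines g at the centre, and pairing with a head vector then determines g at that end. -/
theorem invSq_endVec (hneg : (starPlumbing b c).NegDef) (hc : ∀ i, c i ≠ []) {A : ℤ}
    {p : Fin k → ℤ} (hp : ∀ i, tailCont (c i) 0 * p i = A) (hA : 0 < A) (n : ℤ) (ε : Fin k → ℤ) :
    (starDet b c A p : ℚ) * (starPlumbing b c).invSq (endVec c hc n ε) =
      -((n * A + ∑ i, ε i * p i : ℤ) : ℚ) ^ 2 / A -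
        ∑ i, (ε i : ℚ) ^ 2 *
          (starDet b c A p * headCont (c i) (c i).length / tailCont (c i) 0) := by
  set L : StarVertex c → ℚ := fun v => (endVec c hc n ε v : ℚ) with hL
  set g := ((starPlumbing b c).matrix.map (Int.cast : ℤ → ℚ))⁻¹ *ᵥ L with hg
  set E := starDet b c A p with hE
  have hA' : (A : ℚ) ≠ 0 := by exact_mod_cast hA.ne'
  have hsingle : ∀ (v : StarVertex c) (m : ℤ) (x : StarVertex c → ℚ),
      (fun w => ((Pi.single v m : StarVertex c → ℤ) w : ℚ)) ⬝ᵥ x = m * x v := by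
    intro v m x
    have : (fun w => ((Pi.single v m : StarVertex c → ℤ) w : ℚ)) = Pi.single v (m : ℚ) := by
      funext w
      exact Pi.apply_single (fun _ (z : ℤ) => (z : ℚ)) (fun _ => Int.cast_zero) _ _ _
    rw [this, single_dotProduct]
  have h0 : -(E : ℚ) * g none = ((n * A + ∑ i, ε i * p i : ℤ) : ℚ) := by
    have h := hneg.dotProduct_inv_mulVec (centerVec c A p) L
    rw [matrix_mulVec_centerVec b c hp, hsingle, dotProduct_comm, cast_endVec_dotProduct] at h
    simp only [centerVec_leaf] at h
    push_cast at h ⊢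
    exact h
  have h1 : ∀ i, g none - tailCont (c i) 0 * g (leaf c hc i) =
      ε i * headCont (c i) (c i).length := by
    intro i
    have h := hneg.dotProduct_inv_mulVec (headVec c i) L
    rw [matrix_mulVec_headVec b c hc, headCont_length_succ c hc, dotProduct_comm (fun v => _) L,
      cast_endVec_dotProduct] at h
    simp only [Pi.sub_apply, Int.cast_sub] at h
    rw [show (fun v => (((Pi.single none 1 : StarVertex c → ℤ) v : ℚ) -
        ((Pi.single (leaf c hc i) (tailCont (c i) 0) : StarVertex c → ℤ) v : ℚ))) =
        (fun v => ((Pi.single none 1 : StarVertex c → ℤ) v : ℚ)) -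
        fun v => ((Pi.single (leaf c hc i) (tailCont (c i) 0) : StarVertex c → ℤ) v : ℚ) from rfl,
      sub_dotProduct, hsingle, hsingle] at h
    simp only [headVec_leaf] at h
    rw [Finset.sum_eq_single i (fun i' _ hi => by simp [hi]) (by simp)] at h
    simpa [headVec] using h
  have hr : ∀ i, (tailCont (c i) 0 : ℚ) ≠ 0 := fun i => by
    exact_mod_cast (tailCont_pos hneg i (Nat.zero_le _)).ne'
  have hp' : ∀ i, (p i : ℚ) / A = 1 / tailCont (c i) 0 := by
    intro i
    rw [div_eq_div_iff hA' (hr i), one_mul, mul_comm]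
    exact_mod_cast hp i
  have h2 : ∀ i, g (leaf c hc i) = g none * (p i / A) -
      ε i * (headCont (c i) (c i).length / tailCont (c i) 0) := by
    intro i
    rw [hp', mul_one_div, ← mul_div_assoc, ← sub_div, eq_div_iff (hr i), ← h1 i]
    ring
  have h3 : (starPlumbing b c).invSq (endVec c hc n ε) =
      g none * ((n * A + ∑ i, ε i * p i : ℤ) : ℚ) / A -
        ∑ i, (ε i : ℚ) ^ 2 * (headCont (c i) (c i).length / tailCont (c i) 0) := by
    rw [Plumbing.invSq, cast_endVec_dotProduct]
    simp only [← hL, ← hg, h2, mul_sub, Finset.sum_sub_distrib]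
    push_cast
    rw [mul_add, add_div, Finset.mul_sum, Finset.sum_div, add_sub_assoc]
    congr 1
    · field_simp
    · congr 1
      · exact Finset.sum_congr rfl fun i _ => by ring
      · exact Finset.sum_congr rfl fun i _ => by ring
  rw [h3, mul_sub, Finset.mul_sum]
  congr 1
  · rw [← h0]
    ring
  · exact Finset.sum_congr rfl fun i _ => by ring

/-- The diagonal adjugate entry is det M times that of M⁻¹, which is `invSq_endVec` at a single end.
The added A/aᵢ² cancels the square term and leaves the coefficient of εᵢ² in that lemma. -/
theorem adjugate_leaf (hneg : (starPlumbing b c).NegDef) (hc : ∀ i, c i ≠ []) {A : ℤ}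
    {p : Fin k → ℤ} (hp : ∀ i, tailCont (c i) 0 * p i = A) (hA : A = ∏ i, tailCont (c i) 0)
    (i : Fin k) :
    (((-1) ^ Fintype.card (StarVertex c) *
      (starPlumbing b c).matrix.adjugate (leaf c hc i) (leaf c hc i) : ℤ) : ℚ) +
      A / (tailCont (c i) 0 : ℚ) ^ 2 =
    -(starDet b c A p * headCont (c i) (c i).length / tailCont (c i) 0) := by
  have hA0 : 0 < A := by
    rw [hA]
    exact Finset.prod_pos fun i _ => tailCont_pos hneg i (Nat.zero_le _)
  have h := invSq_endVec hneg hc hp hA0 0 (Pi.single i 1)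
  have he : endVec c hc 0 (Pi.single i 1) = Pi.single (leaf c hc i) 1 := by
    rw [endVec, Pi.single_zero, zero_add, Finset.sum_eq_single i (fun j _ hj => by simp [hj])
      (by simp), Pi.single_eq_same]
  have hsum : ∑ j, (Pi.single i 1 : Fin k → ℤ) j * p j = p i := by
    rw [Finset.sum_eq_single i (fun j _ hj => by simp [hj]) (by simp)]
    simp
  have hsum2 : ∑ j, (((Pi.single i 1 : Fin k → ℤ) j : ℤ) : ℚ) ^ 2 *
      (starDet b c A p * headCont (c j) (c j).length / tailCont (c j) 0) =
      starDet b c A p * headCont (c i) (c i).length / tailCont (c i) 0 := by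
    rw [Finset.sum_eq_single i (fun j _ hj => by simp [hj]) (by simp)]
    simp
  rw [he, hsum, hsum2, zero_mul, zero_add] at h
  have hr : (tailCont (c i) 0 : ℚ) ≠ 0 := by
    exact_mod_cast (tailCont_pos hneg i (Nat.zero_le _)).ne'
  have hp' : (tailCont (c i) 0 : ℚ) * p i = A := by exact_mod_cast hp i
  have hA' : (A : ℚ) ≠ 0 := by exact_mod_cast hA0.ne'
  rw [Int.cast_mul, hneg.cast_adjugate_diag, det_matrix hneg hp hA]
  push_cast
  rw [mul_assoc _ (starDet b c A p : ℚ), h, ← mul_assoc, ← mul_pow, neg_one_mul, neg_neg, one_pow,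
    one_mul]
  have hq : (p i : ℚ) ^ 2 / A = A / (tailCont (c i) 0 : ℚ) ^ 2 := by
    rw [div_eq_div_iff hA' (pow_ne_zero _ hr), ← hp']
    ring
  rw [neg_div, hq]
  ring

theorem cardH_eq (hneg : (starPlumbing b c).NegDef) {A : ℤ}
    {p : Fin k → ℤ} (hp : ∀ i, tailCont (c i) 0 * p i = A) (hA : A = ∏ i, tailCont (c i) 0) :
    (cardH b c : ℤ) = starDet b c A p := by
  have hA0 : 0 < A := by
    rw [hA]
    exact Finset.prod_pos fun i _ => tailCont_pos hneg i (Nat.zero_le _)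
  rw [cardH, Plumbing.natCard_H1 _ hneg.det_ne_zero, det_matrix hneg hp hA, Int.natAbs_mul,
    Int.natAbs_pow, Int.natAbs_neg, Int.natAbs_one, one_pow, one_mul]
  exact Int.natAbs_of_nonneg (starDet_pos hneg hp hA0).le

end StarInverse

theorem finsum_comp_injective {α β : Type*} {f : α → ℚ} {g : β → α} (hg : Function.Injective g)
    (hf : Function.support f ⊆ Set.range g) : ∑ᶠ j, f (g j) = ∑ᶠ i, f i := by
  rw [← finsum_mem_range hg, finsum_mem_def, Set.indicator_eq_self.2 hf]

/-! ### The total series as a sum over covectors, and finiteness -/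

namespace Plumbing

variable {V : Type*} [Fintype V] [DecidableEq V] (Γ : Plumbing V)

theorem matrix_mulVec_ones (v : V) :
    (Γ.matrix *ᵥ ones) v = Γ.weight v + Γ.degree v := by
  classical
  have h : ∀ w, Γ.matrix v w * ones w =
      (if v = w then Γ.weight v else 0) + (if Γ.graph.Adj v w then 1 else 0) := by
    intro w
    by_cases hw : v = w
    · subst hw; simp [matrix, ones]
    · simp [matrix, ones, hw]
  rw [Matrix.mulVec, dotProduct, Finset.sum_congr rfl fun w _ => h w, Finset.sum_add_distrib,
    Finset.sum_ite_eq, if_pos (Finset.mem_univ _), degree, Set.ncard_eq_toFinset_card']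
  simp

/-- The map y ↦ m + 2y induces a surjection from H. -/
theorem finite_spinC [Finite Γ.H1] : Finite Γ.SpinC := by
  let f : Γ.H1 → Γ.SpinC := fun y =>
    Quotient.map' (s₂ := Γ.spinSetoid) (fun y : V → ℤ =>
      (⟨Γ.weight + 2 • y, fun v => by simp [Int.modEq_iff_dvd]⟩ : Γ.CharVec)) (by
        intro y y' h
        rw [Submodule.quotientRel_def, LinearMap.mem_range] at h
        obtain ⟨z, hz⟩ := h
        refine ⟨-z, ?_⟩
        change Γ.weight + 2 • y' = Γ.weight + 2 • y + 2 • (Γ.matrix *ᵥ (-z))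
        rw [Matrix.mulVec_neg, ← Matrix.mulVecLin_apply, hz, smul_neg, smul_sub]
        abel) y
  refine Finite.of_surjective f ?_
  rintro ⟨κ⟩
  have h : ∀ v, ∃ y, κ.1 v = Γ.weight v + 2 * y := by
    intro v
    obtain ⟨y, hy⟩ := (κ.2 v).symm.dvd
    exact ⟨y, by linarith⟩
  choose y hy using h
  refine ⟨Submodule.Quotient.mk y, ?_⟩
  change (Quotient.mk Γ.spinSetoid _) = Quotient.mk Γ.spinSetoid κ
  congr 1
  apply Subtype.ext
  funext v
  simp [hy]

/-- The covector `2Mx + κ - Mu`. -/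
noncomputable def covec (κ x : V → ℤ) : V → ℤ := 2 • (Γ.matrix *ᵥ x) + κ - Γ.matrix *ᵥ ones

theorem theta_add_form (κ x : V → ℤ) :
    Γ.theta κ + (Γ.form x ones : ℚ) = ((∑ v, Γ.covec κ x v : ℤ) : ℚ) / 2 := by
  have h : ∑ v, Γ.covec κ x v = 2 * Γ.form x ones + κ ⬝ᵥ ones - Γ.form ones ones := by
    rw [form, form, dotProduct_mulVec_comm Γ x]
    simp [covec, dotProduct, ones, Finset.sum_add_distrib, Finset.sum_sub_distrib, Finset.mul_sum]
  rw [h, theta]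
  push_cast
  ring

variable {Γ}

theorem epsilon_eq (h : Γ.NegDef) (κ x : V → ℤ) :
    Γ.epsilon κ x = -(Γ.invSq (Γ.covec κ x) + 3 * (Fintype.card V : ℚ) +
      ∑ v, (Γ.weight v : ℚ)) / 4 := by
  have h1 : Γ.covec κ x = (κ - Γ.matrix *ᵥ ones) + 2 • (Γ.matrix *ᵥ x) := by
    rw [covec]; abel
  rw [h1, invSq_add h, epsilon, chi, sub_dotProduct, dotProduct_comm (Γ.matrix *ᵥ ones), ← form]
  push_cast
  ring

theorem NegDef.weight_neg (h : Γ.NegDef) (v : V) : Γ.weight v < 0 := by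
  have h1 := h.form_neg (x := Pi.single v 1) (by simp)
  simpa [form, matrix] using h1

/-- A Cauchy–Schwarz inequality. -/
theorem NegDef.sq_le_weight_mul_invSq (h : Γ.NegDef) (l : V → ℤ) (v : V) :
    (l v : ℚ) ^ 2 ≤ Γ.weight v * Γ.invSq l := by
  set N := Γ.matrix.map (Int.cast : ℤ → ℚ) with hN
  set g := N⁻¹ *ᵥ fun w => (l w : ℚ) with hg
  have hNg : N *ᵥ g = fun w => (l w : ℚ) := by
    rw [hg, Matrix.mulVec_mulVec, Matrix.mul_nonsing_inv _ h.isUnit_det, Matrix.one_mulVec]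
  have hw : (Γ.weight v : ℚ) < 0 := by exact_mod_cast h.weight_neg v
  have hNvv : N v v = Γ.weight v := by simp [hN, matrix]
  have hform : ∀ y : V → ℚ, y ⬝ᵥ (N *ᵥ y) ≤ 0 := by
    intro y
    by_cases hy : y = 0
    · simp [hy]
    · exact (h.rat_form_neg hy).le
  have hsym : ∀ s : ℚ, g ⬝ᵥ (N *ᵥ Pi.single v s) = s * l v := by
    intro s
    have hT : Nᵀ = N := by rw [hN, ← Matrix.transpose_map, matrix_transpose]
    rw [Matrix.dotProduct_mulVec, ← Matrix.mulVec_transpose, hT, hNg, dotProduct_single, mul_comm]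
  -- The multiple of the basis vector that makes this difference orthogonal to it for the form.
  have h1 := hform (g - Pi.single v (l v / Γ.weight v : ℚ))
  rw [Matrix.mulVec_sub, sub_dotProduct, dotProduct_sub, dotProduct_sub, hNg, hsym,
    single_dotProduct, single_dotProduct, Matrix.mulVec_single] at h1
  simp only [Pi.smul_apply, Matrix.col_apply, hNvv, MulOpposite.smul_eq_mul_unop,
    MulOpposite.unop_op] at h1
  have h2 : Γ.invSq l = g ⬝ᵥ fun w => (l w : ℚ) := by
    rw [invSq, dotProduct_comm]
  rw [h2]
  have h3 : (g ⬝ᵥ fun w => (l w : ℚ)) ≤ (l v : ℚ) ^ 2 / Γ.weight v := by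
    have h4 : (Γ.weight v : ℚ) * (l v / Γ.weight v) = l v := mul_div_cancel₀ _ hw.ne
    rw [h4] at h1
    have h5 : (l v : ℚ) ^ 2 / Γ.weight v = l v / Γ.weight v * l v := by ring
    rw [h5]
    linarith
  rw [le_div_iff_of_neg hw] at h3
  linarith

theorem NegDef.finite_invSq_ge (h : Γ.NegDef) (C : ℚ) : {l : V → ℤ | C ≤ Γ.invSq l}.Finite := by
  have hfin : (Set.pi Set.univ fun v => {n : ℤ | (n : ℚ) ^ 2 ≤ Γ.weight v * C}).Finite := by
    refine Set.Finite.pi fun v => ?_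
    refine (Set.finite_Icc (-⌈(Γ.weight v * C : ℚ)⌉) ⌈(Γ.weight v * C : ℚ)⌉).subset ?_
    intro n hn
    have h1 : ((n ^ 2 : ℤ) : ℚ) ≤ ⌈(Γ.weight v * C : ℚ)⌉ := by
      push_cast
      exact le_trans hn (Int.le_ceil _)
    have h2 : n ^ 2 ≤ ⌈(Γ.weight v * C : ℚ)⌉ := by exact_mod_cast h1
    -- Uses |n| ≤ n² for integers.
    constructor <;> nlinarith
  refine hfin.subset fun l hl v _ => ?_
  have hw : (Γ.weight v : ℚ) < 0 := by exact_mod_cast h.weight_neg v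
  exact (h.sq_le_weight_mul_invSq l v).trans (mul_le_mul_of_nonpos_left hl hw.le)

theorem NegDef.mulVec_injective (h : Γ.NegDef) :
    Function.Injective fun x : V → ℤ => Γ.matrix *ᵥ x :=
  Matrix.mulVec_injective_of_det_ne_zero h.det_ne_zero

theorem NegDef.covec_injective (h : Γ.NegDef) (κ : V → ℤ) :
    Function.Injective (Γ.covec κ) := by
  intro x y hxy
  apply h.mulVec_injective
  have h1 : 2 • (Γ.matrix *ᵥ x) = 2 • (Γ.matrix *ᵥ y) := by
    simpa [covec] using hxy
  exact smul_right_injective _ (two_ne_zero (α := ℕ)) h1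

theorem NegDef.finite_epsilon_le (h : Γ.NegDef) (κ : V → ℤ) (e : ℚ) :
    {x | Γ.epsilon κ x ≤ e}.Finite := by
  refine ((h.finite_invSq_ge (-4 * e - 3 * (Fintype.card V : ℚ) -
    ∑ v, (Γ.weight v : ℚ))).preimage (h.covec_injective κ).injOn).subset fun x hx => ?_
  have hx' : Γ.epsilon κ x ≤ e := hx
  rw [epsilon_eq h] at hx'
  simp only [Set.mem_preimage, Set.mem_ofPred_eq]
  linarith

theorem NegDef.finite_H1 (h : Γ.NegDef) : Finite Γ.H1 := by
  apply Nat.finite_of_card_ne_zero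
  rw [Γ.natCard_H1 h.det_ne_zero]
  exact Int.natAbs_ne_zero.2 h.det_ne_zero

/-- The total series as a sum over covectors. -/
theorem totalSeries_eq (h : Γ.NegDef) (W : ℕ → ℤ → ℚ)
    (hW : ∀ (d : ℕ) (n : ℤ), Odd (n - d) → W d n = 0) (a e : ℚ) :
    Γ.totalSeries h W a e = ∑ᶠ (l : V → ℤ) (_ : ((∑ v, l v : ℤ) : ℚ) / 2 = a ∧
      -(Γ.invSq l + 3 * (Fintype.card V : ℚ) + ∑ v, (Γ.weight v : ℚ)) / 4 = e),
      ∏ v, W (Γ.degree v) (l v) := by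
  classical
  have := h.finite_H1
  have := Γ.finite_spinC
  set T : (V → ℤ) → ℚ := fun l => ∑ᶠ (_ : ((∑ v, l v : ℤ) : ℚ) / 2 = a ∧
      -(Γ.invSq l + 3 * (Fintype.card V : ℚ) + ∑ v, (Γ.weight v : ℚ)) / 4 = e),
      ∏ v, W (Γ.degree v) (l v) with hT
  let Φ : Γ.SpinC × (V → ℤ) → V → ℤ := fun p =>
    Γ.covec (Quotient.out (s := Γ.spinSetoid) p.1).1 p.2
  have h1 : Γ.totalSeries h W a e = ∑ᶠ σ : Γ.SpinC, ∑ᶠ x : V → ℤ, T (Φ (σ, x)) := by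
    refine finsum_congr fun σ => ?_
    have h2 : Γ.series h W σ = Γ.seriesOfRep W (Quotient.out (s := Γ.spinSetoid) σ).1 := by
      conv_lhs => rw [← Quotient.out_eq (s := Γ.spinSetoid) σ]
      rfl
    rw [h2, seriesOfRep]
    refine finsum_congr fun x => ?_
    rw [theta_add_form, epsilon_eq h]
    rfl
  have hinj : Function.Injective Φ := by
    rintro ⟨σ, x⟩ ⟨σ', x'⟩ hxx
    have h2 : σ = σ' := by
      rw [← Quotient.out_eq (s := Γ.spinSetoid) σ, ← Quotient.out_eq (s := Γ.spinSetoid) σ']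
      refine Quotient.sound (s := Γ.spinSetoid) ⟨x - x', ?_⟩
      simp only [Φ, covec, sub_left_inj] at hxx
      rw [Matrix.mulVec_sub, smul_sub]
      exact (eq_sub_of_add_eq' hxx.symm).trans (by abel)
    subst h2
    exact congrArg (Prod.mk σ) (h.covec_injective _ hxx)
  -- A nonvanishing weight forces l ≡ δ mod 2, so l + Mu ≡ m is characteristic; its class and its
  -- offset from the chosen representative form the preimage.
  have hsupp : Function.support T ⊆ Set.range Φ := by
    intro l hl
    have hl' : ∏ v, W (Γ.degree v) (l v) ≠ 0 := by
      intro h0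
      apply hl
      simp [hT, h0]
    rw [Finset.prod_ne_zero_iff] at hl'
    have hκ : ∀ v, (l + Γ.matrix *ᵥ ones) v ≡ Γ.weight v [ZMOD 2] := by
      intro v
      have h2 : ¬ Odd (l v - Γ.degree v) := fun h0 => hl' v (Finset.mem_univ _) (hW _ _ h0)
      rw [Int.not_odd_iff_even] at h2
      obtain ⟨r, hr⟩ := h2
      rw [Pi.add_apply, matrix_mulVec_ones]
      exact (Int.modEq_iff_dvd.2 ⟨-(r + Γ.degree v), by linarith⟩)
    let κ : Γ.CharVec := ⟨l + Γ.matrix *ᵥ ones, hκ⟩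
    obtain ⟨y, hy⟩ := Quotient.exact (s := Γ.spinSetoid)
      (Quotient.out_eq (s := Γ.spinSetoid) (Quotient.mk Γ.spinSetoid κ))
    refine ⟨(Quotient.mk Γ.spinSetoid κ, y), ?_⟩
    have hy' : l + Γ.matrix *ᵥ ones = _ := hy
    simp only [Φ, covec]
    rw [add_comm (2 • _), ← hy', add_sub_cancel_right]
  -- Fixing the q-exponent bounds the form; finiteness is what allows the double sum to be merged.
  have hfin : (Function.support T).Finite := by
    refine (h.finite_invSq_ge (-4 * e - 3 * (Fintype.card V : ℚ) -
      ∑ v, (Γ.weight v : ℚ))).subset fun l hl => ?_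
    by_contra hl'
    apply hl
    rw [hT]
    simp only
    rw [finsum_eq_if, if_neg]
    rintro ⟨-, h2⟩
    apply hl'
    simp only [Set.mem_ofPred_eq]
    linarith
  rw [h1, ← finsum_comp_injective hinj hsupp, finsum_curry]
  exact hfin.preimage hinj.injOn

end Plumbing

/-! ### The series of a star as a sum over signs and an integer -/

section StarSeries

variable {k : ℕ} (b : ℤ) (c : Fin k → List ℤ)

/-- The degree is read off from Mu = m + δ, as is that of the other vertices below. -/
theorem degree_none (hc : ∀ i, c i ≠ []) : (starPlumbing b c).degree none = k := by
  have hlen : ∀ i, 0 < (c i).length := fun i => List.length_pos_of_ne_nil (hc i)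
  have h := (starPlumbing b c).matrix_mulVec_ones none
  rw [matrix_mulVec_none] at h
  simp [alongLeg, hlen, Plumbing.ones, starPlumbing] at h
  exact_mod_cast h.symm

theorem degree_some (i : Fin k) (j : Fin (c i).length) :
    (starPlumbing b c).degree (some ⟨i, j⟩) = if j.1 + 1 = (c i).length then 1 else 2 := by
  have h := (starPlumbing b c).matrix_mulVec_ones (some ⟨i, j⟩)
  have h1 : alongLeg c Plumbing.ones i j = 1 := by
    obtain ⟨j, hj⟩ := j
    cases j with
    | zero => rfl
    | succ j => simp [alongLeg, Plumbing.ones, show j < (c i).length by omega]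
  have h2 : alongLeg c Plumbing.ones i (j + 1) = 1 := by simp [alongLeg, Plumbing.ones]
  have h3 : alongLeg c Plumbing.ones i (j + 2) = if j.1 + 1 = (c i).length then 0 else 1 := by
    have := j.2
    simp only [alongLeg, Plumbing.ones]
    split_ifs <;> first | rfl | omega
  rw [matrix_mulVec_some, h1, h2, h3] at h
  have h4 : (starPlumbing b c).weight (some ⟨i, j⟩) = -((c i).get j) := rfl
  rw [h4] at h
  split_ifs at h ⊢ <;> omega

variable {c}

theorem some_eq_leaf_iff (hc : ∀ i, c i ≠ []) (i i' : Fin k) (j : Fin (c i).length) :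
    some ⟨i, j⟩ = leaf c hc i' ↔ i = i' ∧ j.1 + 1 = (c i).length := by
  have := j.2
  constructor
  · intro h
    simp only [leaf, Option.some.injEq, Sigma.mk.injEq] at h
    obtain ⟨rfl, h⟩ := h
    simp only [heq_eq_eq, Fin.ext_iff] at h
    exact ⟨rfl, by omega⟩
  · rintro ⟨rfl, h⟩
    simp only [leaf, Option.some.injEq, Sigma.mk.injEq, heq_eq_eq, true_and, Fin.ext_iff]
    omega

theorem endVec_none (hc : ∀ i, c i ≠ []) (n : ℤ) (ε : Fin k → ℤ) : endVec c hc n ε none = n := by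
  simp [endVec, leaf]

theorem endVec_some (hc : ∀ i, c i ≠ []) (n : ℤ) (ε : Fin k → ℤ) (i : Fin k)
    (j : Fin (c i).length) :
    endVec c hc n ε (some ⟨i, j⟩) = if j.1 + 1 = (c i).length then ε i else 0 := by
  simp only [endVec, Pi.add_apply, Finset.sum_apply, Pi.single_apply, some_eq_leaf_iff, reduceCtorEq,
    if_false, zero_add]
  split_ifs with h <;> simp [h]

theorem endVec_leaf (hc : ∀ i, c i ≠ []) (n : ℤ) (ε : Fin k → ℤ) (i : Fin k) :
    endVec c hc n ε (leaf c hc i) = ε i := by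
  have := List.length_pos_of_ne_nil (hc i)
  rw [leaf, endVec_some, if_pos (by simp; omega)]

theorem sum_endVec (hc : ∀ i, c i ≠ []) (n : ℤ) (ε : Fin k → ℤ) :
    ∑ v, endVec c hc n ε v = n + ∑ i, ε i := by
  simp only [endVec, Pi.add_apply, Finset.sum_add_distrib, Finset.sum_apply]
  rw [Finset.sum_comm]
  simp

theorem prod_What_endVec (hc : ∀ i, c i ≠ []) (n : ℤ) (ε : Fin k → ℤ) :
    ∏ v, What ((starPlumbing b c).degree v) (endVec c hc n ε v) =
      What k n * ∏ i, What 1 (ε i) := by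
  rw [Fintype.prod_option, Fintype.prod_sigma, degree_none b c hc, endVec_none]
  congr 1
  refine Finset.prod_congr rfl fun i _ => ?_
  have hlen := List.length_pos_of_ne_nil (hc i)
  have hlast : (c i).length - 1 + 1 = (c i).length := by omega
  rw [Finset.prod_eq_single ⟨(c i).length - 1, by omega⟩]
  · rw [degree_some, endVec_some, if_pos hlast, if_pos hlast]
  · intro j _ hj
    have : ¬ j.1 + 1 = (c i).length := by
      intro h
      apply hj
      simp only [Fin.ext_iff]
      omega
    rw [degree_some, endVec_some, if_neg this, if_neg this, What_two, if_pos rfl]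
  · simp

/-- Covectors with nonzero weight are supported at the centre and the ends of the legs. -/
theorem exists_eq_endVec (hc : ∀ i, c i ≠ []) {l : StarVertex c → ℤ}
    (hl : ∏ v, What ((starPlumbing b c).degree v) (l v) ≠ 0) :
    ∃ (η : Fin k → ℤˣ) (n : ℤ), endVec c hc (-n) (fun i => -(η i : ℤ)) = l := by
  rw [Finset.prod_ne_zero_iff] at hl
  have hleaf : ∀ i, ∃ u : ℤˣ, -(u : ℤ) = l (leaf c hc i) := by
    intro i
    have hlen := List.length_pos_of_ne_nil (hc i)
    have h := hl (leaf c hc i) (Finset.mem_univ _)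
    have hd : (starPlumbing b c).degree (leaf c hc i) = 1 := by
      rw [leaf, degree_some, if_pos (by simp; omega)]
    rw [hd, What_one] at h
    split_ifs at h with h1 h2
    · exact ⟨-1, by simp [h1]⟩
    · exact ⟨1, by simp [h2]⟩
    · exact absurd rfl h
  choose η hη using hleaf
  refine ⟨η, -l none, ?_⟩
  funext v
  rcases v with _ | ⟨i, j⟩
  · rw [endVec_none, neg_neg]
  · rw [endVec_some]
    split_ifs with h
    · rw [hη, (some_eq_leaf_iff hc i i j).2 ⟨rfl, h⟩]
    · have h1 := hl (some ⟨i, j⟩) (Finset.mem_univ _)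
      rw [degree_some, if_neg h, What_two] at h1
      by_contra h2
      exact h1 (if_neg (Ne.symm h2))

theorem endVec_injective (hc : ∀ i, c i ≠ []) :
    Function.Injective fun q : (Fin k → ℤˣ) × ℤ => endVec c hc (-q.2) (fun i => -(q.1 i : ℤ)) := by
  rintro ⟨η, n⟩ ⟨η', n'⟩ h
  simp only at h
  have h1 := congrFun h none
  rw [endVec_none, endVec_none, neg_inj] at h1
  have h2 : η = η' := by
    funext i
    have h3 := congrFun h (leaf c hc i)
    rw [endVec_leaf, endVec_leaf, neg_inj] at h3
    exact Units.ext h3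
  rw [h1, h2]

variable {b}

/-- The covector has entries -n and -ηᵢ because Ŵ reads the coefficient of the inverse power; with
this sign each end contributes Ŵ₁(-ηᵢ) = ηᵢ, and (η, n) are the indices used for f₀. -/
theorem Zhathat_eq (hneg : (starPlumbing b c).NegDef) (hc : ∀ i, c i ≠ []) (r e : ℚ) :
    (starPlumbing b c).Zhathat hneg r e =
      ∑ η : Fin k → ℤˣ, ∑ᶠ (n : ℤ) (_ : ((-n + ∑ i, -(η i : ℤ) : ℤ) : ℚ) / 2 = r ∧
        -((starPlumbing b c).invSq (endVec c hc (-n) (fun i => -(η i : ℤ))) +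
          3 * (Fintype.card (StarVertex c) : ℚ) + ∑ v, ((starPlumbing b c).weight v : ℚ)) / 4 = e),
        What k (-n) * ((∏ i, (η i : ℤ) : ℤ) : ℚ) := by
  classical
  rw [Plumbing.Zhathat, Plumbing.totalSeries_eq hneg _ What_eq_zero_of_odd]
  set T : (StarVertex c → ℤ) → ℚ := fun l => ∑ᶠ (_ : ((∑ v, l v : ℤ) : ℚ) / 2 = r ∧
      -((starPlumbing b c).invSq l + 3 * (Fintype.card (StarVertex c) : ℚ) +
        ∑ v, ((starPlumbing b c).weight v : ℚ)) / 4 = e),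
      ∏ v, What ((starPlumbing b c).degree v) (l v) with hT
  have hsupp : Function.support T ⊆ Set.range fun q : (Fin k → ℤˣ) × ℤ =>
      endVec c hc (-q.2) (fun i => -(q.1 i : ℤ)) := by
    intro l hl
    obtain ⟨η, n, h⟩ := exists_eq_endVec b hc (l := l) (by
      intro h0
      apply hl
      simp only [hT, h0, finsum_zero])
    exact ⟨(η, n), h⟩
  have hfin : (Function.support T).Finite := by
    refine (hneg.finite_invSq_ge (-4 * e - 3 * (Fintype.card (StarVertex c) : ℚ) -
      ∑ v, ((starPlumbing b c).weight v : ℚ))).subset fun l hl => ?_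
    by_contra hl'
    apply hl
    rw [hT]
    simp only
    rw [finsum_eq_if, if_neg]
    rintro ⟨-, h2⟩
    apply hl'
    simp only [Set.mem_ofPred_eq]
    linarith
  rw [← finsum_comp_injective (endVec_injective hc) hsupp, finsum_curry _
    (hfin.preimage (endVec_injective hc).injOn), finsum_eq_sum_of_fintype]
  refine Finset.sum_congr rfl fun η _ => finsum_congr fun n => ?_
  have hprod : ∏ i, What 1 (-(η i : ℤ)) = ((∏ i, (η i : ℤ) : ℤ) : ℚ) := by
    push_cast
    refine Finset.prod_congr rfl fun i _ => ?_
    rw [What_one]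
    rcases Int.units_eq_one_or (η i) with h | h <;> simp [h]
  rw [hT]
  simp only
  rw [sum_endVec, prod_What_endVec, hprod]

end StarSeries

/-! ### The Laplace transform of the expansion of f₀ -/

section LaplaceSeries

theorem finite_sq_eq (A : ℕ) (hA : 0 < A) (e : ℚ) :
    {n : ℤ | (n : ℚ) ^ 2 / (4 * (A : ℚ)) = e}.Finite := by
  have hA' : (4 * (A : ℚ)) ≠ 0 := by positivity
  by_cases h : ∃ n₀ : ℤ, (n₀ : ℚ) ^ 2 / (4 * (A : ℚ)) = e
  · obtain ⟨n₀, rfl⟩ := h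
    refine (Set.toFinite {n₀, -n₀}).subset fun n hn => ?_
    have hn' : (n : ℚ) ^ 2 / (4 * (A : ℚ)) = (n₀ : ℚ) ^ 2 / (4 * (A : ℚ)) := hn
    rw [div_left_inj' hA'] at hn'
    have h1 : n ^ 2 = n₀ ^ 2 := by exact_mod_cast hn'
    rcases sq_eq_sq_iff_eq_or_eq_neg.1 h1 with h2 | h2 <;> simp [h2]
  · convert Set.finite_empty
    ext n
    simp only [Set.mem_empty_iff_false, iff_false]
    exact fun hn => h ⟨n, hn⟩

/-- For fixed η the exponent N of z determines that of t, and N contributes only when N = An + Σ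
ηᵢA/aᵢ, so the sum can be reindexed by n. At most two N share a q-exponent, which justifies
exchanging the sums. -/
theorem laplace_fZero {k : ℕ} (a : Fin k → ℕ) (hA : 0 < ∏ j, a j) (r e : ℚ) :
    laplace (∏ j, a j) (symmetricExpansionCoeff (fZero a)) r e =
      ∑ η : Fin k → ℤˣ, ∑ᶠ (n : ℤ) (_ : ((-(n + ∑ i, (η i : ℤ)) : ℤ) : ℚ) = r ∧
        ((((∏ j, a j : ℕ) : ℤ) * n + ∑ i, (η i : ℤ) * ((∏ j, a j) / a i : ℕ) : ℤ) : ℚ) ^ 2 /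
          (4 * ((∏ j, a j : ℕ) : ℚ)) = e),
        ((∏ i, (η i : ℤ) : ℤ) : ℚ) * What k (-n) := by
  classical
  set A := ∏ j, a j with hAdef
  have hA' : (A : ℤ) ≠ 0 := by exact_mod_cast hA.ne'
  set σ : (Fin k → ℤˣ) → ℤ := fun η => ∑ i, (η i : ℤ) * (A / a i : ℕ) with hσ
  set τ : (Fin k → ℤˣ) → ℤ := fun η => ∑ i, (η i : ℤ) with hτ
  set s : (Fin k → ℤˣ) → ℚ := fun η => ((∏ i, (η i : ℤ) : ℤ) : ℚ) with hs
  let F : (Fin k → ℤˣ) → ℤ → ℚ := fun η N =>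
    if (A : ℤ) ∣ N - σ η ∧ ((-((N - σ η) / A + τ η) : ℤ) : ℚ) = r ∧
      (N : ℚ) ^ 2 / (4 * (A : ℚ)) = e then s η * What k (-((N - σ η) / A)) else 0
  have h1 : laplace A (symmetricExpansionCoeff (fZero a)) r e = ∑ᶠ N : ℤ, ∑ η, F η N := by
    refine finsum_congr fun N => ?_
    have h2 : ∀ m : ℤ, (∑ᶠ (_ : (m : ℚ) = r ∧ (N : ℚ) ^ 2 / (4 * (A : ℚ)) = e),
        symmetricExpansionCoeff (fZero a) N m) =
        ∑ η, if m = -((N - σ η) / A + τ η) then F η N else 0 := by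
      intro m
      rw [finsum_eq_if, symmetricExpansionCoeff_fZero a hA]
      by_cases h : (m : ℚ) = r ∧ (N : ℚ) ^ 2 / (4 * (A : ℚ)) = e
      · rw [if_pos h]
        refine Finset.sum_congr rfl fun η _ => ?_
        by_cases hm : m = -((N - σ η) / A + τ η)
        · have h3 : ((-((N - σ η) / A + τ η) : ℤ) : ℚ) = r := by rw [← hm]; exact h.1
          by_cases hd : (A : ℤ) ∣ N - σ η
          · rw [if_pos ⟨hd, hm⟩, if_pos hm]
            exact (if_pos ⟨hd, h3, h.2⟩).symm
          · rw [if_neg (fun h' => hd h'.1), if_pos hm]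
            exact (if_neg (fun h' => hd h'.1)).symm
        · rw [if_neg (fun h' => hm h'.2), if_neg hm]
      · rw [if_neg h]
        refine (Finset.sum_eq_zero fun η _ => ?_).symm
        by_cases hm : m = -((N - σ η) / A + τ η)
        · rw [if_pos hm]
          refine if_neg fun h' => h ⟨?_, h'.2.2⟩
          rw [hm]
          exact h'.2.1
        · rw [if_neg hm]
    rw [finsum_congr h2, finsum_sum_comm]
    · refine Finset.sum_congr rfl fun η _ => ?_
      rw [finsum_eq_single _ (-((N - σ η) / A + τ η)) (fun m hm => if_neg hm), if_pos rfl]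
    · intro η _
      refine (Set.finite_singleton (-((N - σ η) / A + τ η))).subset fun m hm => ?_
      by_contra h
      exact hm (if_neg h)
  rw [h1, finsum_sum_comm]
  · refine Finset.sum_congr rfl fun η _ => ?_
    have hinj : Function.Injective fun n : ℤ => (A : ℤ) * n + σ η := by
      intro n n' h
      exact mul_left_cancel₀ hA' (add_right_cancel h)
    rw [← finsum_comp_injective hinj]
    · refine finsum_congr fun n => ?_
      simp only [F]
      rw [finsum_eq_if, add_sub_cancel_right, Int.mul_ediv_cancel_left _ hA']
      exact if_congr (and_iff_right ⟨n, rfl⟩) rfl rfl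
    · intro N hN
      by_contra h
      refine hN (if_neg fun h' => h ?_)
      obtain ⟨n, hn⟩ := h'.1
      exact ⟨n, by simp only; linarith⟩
  · intro η _
    refine (finite_sq_eq A hA e).subset fun N hN => ?_
    by_contra h
    exact hN (if_neg fun h' => h h'.2.2)

end LaplaceSeries

end Seifert

/-! ### Comparison of the two sums -/

theorem theorem3p3 {k : ℕ} (b : ℤ) (a : Fin k → ℕ) (β : Fin k → ℤ) (c : Fin k → List ℤ)
    (ha : ∀ i, 0 < a i) (hcop : ∀ i, IsCoprime (a i : ℤ) (β i))
    (hc : ∀ i, c i ≠ []) (hcf : ∀ i, Seifert.contFrac (c i) = (a i : ℚ) / (β i : ℚ))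
    (hneg : (Seifert.starPlumbing b c).NegDef) :
    Finite (Seifert.starPlumbing b c).H1 ∧
    Finite (Seifert.starPlumbing b c).SpinC ∧
    (∀ (κ : Seifert.StarVertex c → ℤ) (e : ℚ), {x | (Seifert.starPlumbing b c).epsilon κ x ≤ e}.Finite) ∧
    ((Seifert.starPlumbing b c).Zhathat hneg).subst (Seifert.cardH b c) =
      (Seifert.laplace (∏ i, a i)
        (Seifert.symmetricExpansionCoeff (Seifert.fZero a))).qShift (Seifert.Delta b a c hc) := by
  have hfin := hneg.finite_H1
  refine ⟨hfin, Seifert.Plumbing.finite_spinC _, hneg.finite_epsilon_le, ?_⟩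
  have hr := Seifert.tailCont_eq hneg ha hcop hc hcf
  have hA0 : 0 < ∏ i, a i := Finset.prod_pos fun i _ => ha i
  set A : ℕ := ∏ i, a i with hAdef
  set p : Fin k → ℤ := fun i => ((A / a i : ℕ) : ℤ) with hpdef
  have hdvd : ∀ i, a i ∣ A := fun i => Finset.dvd_prod_of_mem _ (Finset.mem_univ i)
  have hp : ∀ i, Seifert.tailCont (c i) 0 * p i = (A : ℤ) := by
    intro i
    rw [hr]
    change (a i : ℤ) * ((A / a i : ℕ) : ℤ) = A
    exact_mod_cast Nat.mul_div_cancel' (hdvd i)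
  have hA : (A : ℤ) = ∏ i, Seifert.tailCont (c i) 0 := by
    rw [Finset.prod_congr rfl fun i _ => hr i, hAdef, Nat.cast_prod]
  have hH := Seifert.cardH_eq hneg hp hA
  have hHQ : (Seifert.cardH b c : ℚ) = Seifert.starDet b c A p := by exact_mod_cast hH
  have hHpos : (0 : ℚ) < Seifert.cardH b c := by
    rw [hHQ]
    exact_mod_cast Seifert.starDet_pos hneg hp (by exact_mod_cast hA0)
  have hAQ : (0 : ℚ) < A := by exact_mod_cast hA0
  funext r e
  rw [Seifert.TQSeries.subst, Seifert.TQSeries.qShift, Seifert.Zhathat_eq hneg hc,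
    Seifert.laplace_fZero a hA0]
  -- The summands for (η, n) already agree up to order of factors; what remains is that the
  -- conditions on the t- and q-exponents are equivalent.
  refine Finset.sum_congr rfl fun η _ => finsum_congr fun n => ?_
  refine finsum_congr_Prop (propext (and_congr ?_ ?_)) fun _ => mul_comm _ _
  · rw [div_left_inj' two_ne_zero, Finset.sum_neg_distrib, neg_add]
  · have hq := Seifert.invSq_endVec hneg hc hp (by exact_mod_cast hA0) (-n)
      (fun i => -(η i : ℤ))
    have htr : ((Seifert.starPlumbing b c).matrix.trace : ℚ) =
        ∑ v, ((Seifert.starPlumbing b c).weight v : ℚ) := by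
      simp [Matrix.trace, Seifert.Plumbing.matrix]
    -- The factor ηᵢ² = 1 is inserted so that the sum in Δ matches the last sum of `invSq_endVec`
    -- literally.
    have hadj : ∀ i, (((-1) ^ Fintype.card (Seifert.StarVertex c) *
          (Seifert.starPlumbing b c).matrix.adjugate (Seifert.leaf c hc i)
            (Seifert.leaf c hc i) : ℤ) : ℚ) + (A : ℚ) / (a i : ℚ) ^ 2 =
        -(((-(η i : ℤ) : ℤ) : ℚ) ^ 2 * (Seifert.starDet b c A p *
          Seifert.headCont (c i) (c i).length / Seifert.tailCont (c i) 0)) := by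
      intro i
      have h := Seifert.adjugate_leaf hneg hc hp hA i
      have hη : ((-(η i : ℤ) : ℤ) : ℚ) ^ 2 = 1 := by
        rcases Int.units_eq_one_or (η i) with h | h <;> simp [h]
      rw [hη, one_mul, ← h, hr]
      simp
    have hN : ((-n * (A : ℤ) + ∑ i, -(η i : ℤ) * p i : ℤ) : ℚ) ^ 2 =
        (((A : ℤ) * n + ∑ i, (η i : ℤ) * p i : ℤ) : ℚ) ^ 2 := by
      rw [← Int.cast_pow, ← Int.cast_pow]
      congr 1
      simp only [neg_mul, Finset.sum_neg_distrib]
      ring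
    rw [hN, ← hHQ] at hq
    rw [Seifert.Delta, Finset.sum_congr rfl fun i _ => hadj i, htr, eq_div_iff hHpos.ne',
      Finset.sum_neg_distrib, ← hHQ]
    set Q := (Seifert.starPlumbing b c).invSq
      (Seifert.endVec c hc (-n) (fun i => -(η i : ℤ))) with hQ
    set X := (((A : ℤ) * n + ∑ i, (η i : ℤ) * p i : ℤ) : ℚ) ^ 2 with hX
    have hX4 : X / (4 * (A : ℚ)) = X / A / 4 := by rw [div_div, mul_comm]
    rw [hX4]
    have hq' : (Seifert.cardH b c : ℚ) * Q = -(X / A) - ∑ i, ((-(η i : ℤ) : ℤ) : ℚ) ^ 2 *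
        ((Seifert.cardH b c : ℚ) * Seifert.headCont (c i) (c i).length /
          Seifert.tailCont (c i) 0) := by
      rw [hq, neg_div]
      simp
    constructor
    · intro h
      rw [← h]
      linear_combination (1 / 4) * hq'
    · intro h
      linear_combination h - (1 / 4) * hq'
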